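/- Let $d\ge 1$, $0<s<1$. Let $\varphi\in C^2(\mathbb{R}^d)$ be a positive, radially symmetric function, decreasing in $|x|\ge 1$, with decay $|x|^{-(d+2s)}$ at infinity, that is, $c|x|^{-(d+2s)}\le\varphi(x)\le C|x|^{-(d+2s)}$ and $|D^2\varphi(x)|\le c_0|x|^{-(d+2s)-2}$ for $|x|$ large, with constants $c,C,c_0>0$. Write $\varphi_{\rho,x_0}(x)=\varphi((x-x_0)/\rho)$, $\|f\|_{L^1(\varphi)}=\int_{\mathbb{R}^d}|f|\,\varphi\,dx$, and $$(-\Delta)^s\varphi(x)=c_{d,2s}\,\mathrm{P.V.}\!\int_{\mathbb{R}^d}\frac{\varphi(x)-\varphi(z)}{|x-z|^{d+2s}}\,dz,\qquad c_{d,2s}=\frac{2^{2s-1}\,2s\,\Gamma(\frac{d+2s}{2})}{\pi^{d/2}\,\Gamma(1-s)} .$$ (a) There is a constant $K_0>0$ (depending only on $d$, $s$ and $\varphi$) such that $|(-\Delta)^s\varphi|\le K_0\,\varphi$ on $\mathbb{R}^d$. (b) Let $T>0$ and let $u\ge 0$ be a weak solution of the fractional heat equation $\partial_t u+(-\Delta)^s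 u=0$ in $(0,T]\times\mathbb{R}^d$, i.e. $u\in C((0,T];L^1(\mathbb{R}^d))$, $u\in L^2_{\rm loc}((0,T);\dot H^s(\mathbb{R}^d))$, and $$\int_0^T\!\!\int_{\mathbb{R}^d}u\,\partial_t\eta\,dx\,dt-\int_0^T\!\!\int_{\mathbb{R}^d}(-\Delta)^{s/2}u\,(-\Delta)^{s/2}\eta\,dx\,dt=0$$ for every $\eta\in C^1$ with compact support in $(0,T)\times\mathbb{R}^d$. Assume that $\|u(T)\|_{L^1(\varphi)}<\infty$. Then there exists a unique nonnegative Radon measure $\mu$ on $\mathbb{R}^d$ that is the initial trace of $u$, that is, $$\int_{\mathbb{R}^d}\psi\,d\mu=\lim_{t\to0^+}\int_{\mathbb{R}^d}u(t,x)\psi(x)\,dx\qquad\text{for all continuous }\psi\text{ with compact support.}$$ (c) Moreover, let $K_0$ be any constant with $|(-\Delta)^s\varphi|\le K_0\,\varphi$ on $\mathbb{R}^d$, and let $x_0\in\mathbb{R}^d$, $R>0$ and $\rho>0$ be such that $\varphi_{\rho,x_0}\ge1$ on the ball $B_R(x_0)$ (for instance $\rho=R$, if $\varphi\ge1$ on $B_1(0)$;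 or $\rho=1$, if $\varphi\ge1$ on $B_R(0)$). Then $\|u(T)\|_{L^1(\varphi_{\rho,x_0})}<\infty$ and $$\mu(B_R(x_0))\le e^{K_0\rho^{-2s}T}\,\|u(T)\|_{L^1(\varphi_{\rho,x_0})}.$$ -/

import Mathlib

open MeasureTheory Filter Topology
open scoped FourierTransform ENNReal

noncomputable section

namespace FracHeat

/-- Euclidean space `ℝ^d`. -/
abbrev E (d : ℕ) : Type := EuclideanSpace ℝ (Fin d)

/-! ### The fractional Laplacian -/

/-- The constant `c_{d,σ} = 2^(σ-1) σ Γ((d+σ)/2) / (π^(d/2) Γ(1-σ/2))` with `σ = 2s`. -/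
def fracConst (d : ℕ) (s : ℝ) : ℝ :=
  (2 : ℝ) ^ (2 * s - 1) * (2 * s) * Real.Gamma (((d : ℝ) + 2 * s) / 2) /
    (Real.pi ^ ((d : ℝ) / 2) * Real.Gamma (1 - s))

/-- The pointwise fractional Laplacian
`(-Δ)^s g (x) = c_{d,2s} P.V. ∫ (g(x) - g(z)) / |x-z|^(d+2s) dz`; the principal value is the limit
of the integrals over `|x-z| > ε` as `ε → 0+`. It is used for bounded `C²` functions `g` only, for
which this limit exists at every point. -/
def fracLaplacian {d : ℕ} (s : ℝ) (g : E d → ℝ) (x : E d) : ℝ :=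
  fracConst d s *
    limUnder (𝓝[>] (0 : ℝ)) (fun ε : ℝ =>
      ∫ z in {z : E d | ε < ‖x - z‖}, (g x - g z) / ‖x - z‖ ^ ((d : ℝ) + 2 * s))

/-- The function `ξ ↦ (2π|ξ|)^s f̂(ξ)`, i.e. the Fourier transform of `(-Δ)^(s/2) f`,
for `f ∈ L¹`. -/
def fracSymbol {d : ℕ} (s : ℝ) (f : E d → ℝ) (ξ : E d) : ℂ :=
  (((2 * Real.pi * ‖ξ‖) ^ s : ℝ) : ℂ) * 𝓕 (fun x : E d => (f x : ℂ)) ξ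

/-- The homogeneous Sobolev norm `‖f‖_{Ḣ^s} = ‖(2π|ξ|)^s f̂‖_{L²} ∈ [0,∞]`, for `f ∈ L¹`. -/
def hsNorm {d : ℕ} (s : ℝ) (f : E d → ℝ) : ℝ≥0∞ :=
  eLpNorm (fracSymbol s f) 2 volume

open Classical in
/-- `(-Δ)^(s/2) f` as an element of `L²`, for `f ∈ L¹ ∩ Ḣ^s`: the inverse Fourier transform
of `(2π|ξ|)^s f̂`. (It is set to `0` when `(2π|ξ|)^s f̂` is not in `L²`.) -/
def halfFracLaplacian {d : ℕ} (s : ℝ) (f : E d → ℝ) : Lp (α := E d) ℂ 2 :=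
  if h : MemLp (fracSymbol s f) 2 (volume : Measure (E d)) then
    𝓕⁻ (h.toLp (fracSymbol s f))
  else 0

/-- The energy `∫ (-Δ)^(s/2) f (-Δ)^(s/2) g dx`, written as an inner product in (complex) `L²`;
for real `f`, `g` both factors are real. -/
def fracEnergy {d : ℕ} (s : ℝ) (f g : E d → ℝ) : ℝ :=
  (inner ℂ (halfFracLaplacian s f) (halfFracLaplacian s g)).re

/-! ### Weak solutions -/

/-- Weak (`L¹`-energy) solutions of `∂ₜu + (-Δ)^s u = 0` in `(0,T] × ℝ^d`:
`u ∈ C((0,T]; L¹(ℝ^d))`, `u ∈ L²_loc((0,T); Ḣ^s(ℝ^d))`, and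
`∫₀ᵀ∫ u ∂ₜη dx dt - ∫₀ᵀ∫ (-Δ)^(s/2)u (-Δ)^(s/2)η dx dt = 0`
for every `C¹` function `η` with compact support in `(0,T) × ℝ^d`. -/
structure IsWeakSolution {d : ℕ} (s T : ℝ) (u : ℝ → E d → ℝ) : Prop where
  integrable : ∀ t ∈ Set.Ioc 0 T, Integrable (u t) volume
  continuous_L1 : ∀ t₀ ∈ Set.Ioc 0 T,
    Tendsto (fun t => ∫⁻ x, ‖u t x - u t₀ x‖ₑ) (𝓝[Set.Ioc 0 T] t₀) (𝓝 0)
  energy : ∀ a b : ℝ, 0 < a → b < T → ∫⁻ t in Set.Icc a b, hsNorm s (u t) ^ 2 < ∞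
  weak_eq : ∀ η : ℝ × E d → ℝ, ContDiff ℝ 1 η → HasCompactSupport η →
    tsupport η ⊆ Set.Ioo 0 T ×ˢ Set.univ →
    (∫ t in Set.Ioo 0 T, ∫ x, u t x * deriv (fun τ => η (τ, x)) t) -
      (∫ t in Set.Ioo 0 T, fracEnergy s (u t) (fun x => η (t, x))) = 0

/-- `u ≥ 0` in `(0,T] × ℝ^d` (as a curve in `L¹`). -/
def IsNonneg {d : ℕ} (T : ℝ) (u : ℝ → E d → ℝ) : Prop :=
  ∀ t ∈ Set.Ioc 0 T, ∀ᵐ x, 0 ≤ u t x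

/-! ### Weights -/

/-- Weights with decay `|x|^(-α)` at infinity: positive, radially symmetric `C²` functions,
decreasing in `|x| ≥ 1`, comparable to `|x|^(-α)` and with `|D²φ(x)| ≤ c₀ |x|^(-α-2)`
for `|x|` large. -/
structure IsWeight {d : ℕ} (α : ℝ) (φ : E d → ℝ) : Prop where
  contDiff : ContDiff ℝ 2 φ
  pos : ∀ x, 0 < φ x
  radial : ∀ x y, ‖x‖ = ‖y‖ → φ x = φ y
  decreasing : ∀ x y, 1 ≤ ‖x‖ → ‖x‖ ≤ ‖y‖ → φ y ≤ φ x
  decay : ∃ c C r : ℝ, 0 < c ∧ 0 < r ∧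
    ∀ x, r ≤ ‖x‖ → c * ‖x‖ ^ (-α) ≤ φ x ∧ φ x ≤ C * ‖x‖ ^ (-α)
  hessian_decay : ∃ c₀ r : ℝ, 0 < r ∧
    ∀ x, r ≤ ‖x‖ → ‖iteratedFDeriv ℝ 2 φ x‖ ≤ c₀ * ‖x‖ ^ (-α - 2)

/-- The norm `‖f‖_{L¹(φ dx)} ∈ [0,∞]` for a nonnegative weight `φ`. -/
def weightedL1Norm {d : ℕ} (f φ : E d → ℝ) : ℝ≥0∞ :=
  ∫⁻ x, ‖f x‖ₑ * ENNReal.ofReal (φ x)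

/-- The rescaled weight `x ↦ φ((x - x₀)/ρ)`. -/
def rescale {d : ℕ} (φ : E d → ℝ) (x₀ : E d) (ρ : ℝ) (x : E d) : ℝ :=
  φ (ρ⁻¹ • (x - x₀))

/-! ### Initial traces -/

/-- The nonnegative Radon measure `μ` is an initial trace of `u`:
`∫ ψ dμ = lim_{t → 0+} ∫ u(t,x) ψ(x) dx` for all continuous `ψ` with compact support. -/
structure IsInitialTrace {d : ℕ} (u : ℝ → E d → ℝ) (μ : Measure (E d)) : Prop where
  radon : IsFiniteMeasureOnCompacts μ
  tendsto : ∀ ψ : E d → ℝ, Continuous ψ → HasCompactSupport ψ →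
    Tendsto (fun t => ∫ x, u t x * ψ x) (𝓝[>] 0) (𝓝 (∫ x, ψ x ∂μ))

end FracHeat

end

noncomputable section

namespace FracHeat

/-- The centred second difference `2 g(x) - g(x+h) - g(x-h)`. -/
def secondDiff {d : ℕ} (g : E d → ℝ) (x h : E d) : ℝ := 2 * g x - g (x + h) - g (x - h)

/-- Bounded continuous functions with `|2 g(x) - g(x+h) - g(x-h)| ≤ M |h|²`. -/
structure IsC11 {d : ℕ} (M : ℝ) (g : E d → ℝ) : Prop where
  continuous : Continuous g
  bound : ∀ x, |g x| ≤ M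
  second : ∀ x h, |secondDiff g x h| ≤ M * ‖h‖ ^ 2

/-- The Lévy kernel `|h|^(-(d+2s))`. -/
def levyKernel (d : ℕ) (s : ℝ) (h : E d) : ℝ := (‖h‖ ^ ((d : ℝ) + 2 * s))⁻¹

/-- The fractional Laplacian written with centred second differences. -/
def symLap {d : ℕ} (s : ℝ) (g : E d → ℝ) (x : E d) : ℝ :=
  fracConst d s / 2 * ∫ h : E d, secondDiff g x h * levyKernel d s h

/-! ### The Lévy kernel and its integrability -/

section Kernel

variable {d : ℕ} {s : ℝ}

lemma levyKernel_nonneg (h : E d) : 0 ≤ levyKernel d s h := by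
  unfold levyKernel; positivity

lemma levyKernel_neg (h : E d) : levyKernel d s (-h) = levyKernel d s h := by
  simp [levyKernel]

lemma measurable_levyKernel : Measurable (levyKernel d s) := by
  unfold levyKernel; fun_prop

lemma fracConst_pos (hs0 : 0 < s) (hs1 : s < 1) : 0 < fracConst d s := by
  unfold fracConst
  have h1 : 0 < Real.Gamma (((d : ℝ) + 2 * s) / 2) := Real.Gamma_pos_of_pos (by positivity)
  have h2 : 0 < Real.Gamma (1 - s) := Real.Gamma_pos_of_pos (by linarith)
  have := Real.pi_pos
  positivity

/-- In polar coordinates the radial density is r^{1-2s} on (0,1], integrable because s < 1, and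
r^{-1-2s} on (1,∞), integrable because s > 0. -/
lemma integrable_min_levyKernel (hd : 1 ≤ d) (hs0 : 0 < s) (hs1 : s < 1) :
    Integrable (fun h : E d => min 1 (‖h‖ ^ 2) * levyKernel d s h) := by
  have : Nonempty (Fin d) := ⟨⟨0, hd⟩⟩
  have key := (integrable_fun_norm_addHaar (volume : Measure (E d))
    (f := fun r : ℝ => min 1 (r ^ 2) * (r ^ ((d : ℝ) + 2 * s))⁻¹))
  refine key.2 ?_
  have hdim : Module.finrank ℝ (E d) = d := by simp
  rw [hdim, ← Set.Ioc_union_Ioi_eq_Ioi zero_le_one, integrableOn_union]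
  have hcast : ((d - 1 : ℕ) : ℝ) = (d : ℝ) - 1 := by push_cast [hd]; ring
  constructor
  · have h1 : IntegrableOn (fun r : ℝ => r ^ (1 - 2 * s)) (Set.Ioc 0 1) := by
      rw [← intervalIntegrable_iff_integrableOn_Ioc_of_le zero_le_one]
      exact intervalIntegral.intervalIntegrable_rpow' (by linarith)
    refine h1.congr_fun (fun r hr => ?_) measurableSet_Ioc
    have hr0 : 0 < r := hr.1
    have h2 : min 1 (r ^ 2) = r ^ 2 := min_eq_right (pow_le_one₀ hr0.le hr.2)
    simp only [smul_eq_mul]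
    rw [h2, ← Real.rpow_neg hr0.le, ← Real.rpow_natCast r 2, ← Real.rpow_natCast r (d - 1), hcast,
      ← Real.rpow_add hr0, ← Real.rpow_add hr0]
    congr 1; push_cast; ring
  · have h1 : IntegrableOn (fun r : ℝ => r ^ (-1 - 2 * s)) (Set.Ioi 1) :=
      integrableOn_Ioi_rpow_of_lt (by linarith) zero_lt_one
    refine h1.congr_fun (fun r hr => ?_) measurableSet_Ioi
    have hr0 : (0 : ℝ) < r := zero_lt_one.trans hr
    have h2 : min 1 (r ^ 2) = 1 := min_eq_left (one_le_pow₀ (le_of_lt hr))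
    simp only [smul_eq_mul]
    rw [h2, ← Real.rpow_neg hr0.le, ← Real.rpow_natCast r (d - 1), hcast, one_mul,
      ← Real.rpow_add hr0]
    congr 1; ring

/-- The Lévy mass `∫ min(1,|h|²) |h|^(-(d+2s)) dh`. -/
def levyMass (d : ℕ) (s : ℝ) : ℝ := ∫ h : E d, min 1 (‖h‖ ^ 2) * levyKernel d s h

lemma levyMass_nonneg : 0 ≤ levyMass d s :=
  integral_nonneg fun h => mul_nonneg (le_min zero_le_one (by positivity)) (levyKernel_nonneg h)

end Kernel

/-! ### The fractional Laplacian of bounded C^{1,1} functions -/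

section C11

variable {d : ℕ} {s M : ℝ} {g : E d → ℝ}

lemma secondDiff_bound_of_bound (hb : ∀ x, |g x| ≤ M) (x h : E d) :
    |secondDiff g x h| ≤ 4 * M := by
  have h1 := abs_le.1 (hb x)
  have h2 := abs_le.1 (hb (x + h))
  have h3 := abs_le.1 (hb (x - h))
  unfold secondDiff
  rw [abs_le]; constructor <;> linarith [h1.1, h1.2, h2.1, h2.2, h3.1, h3.2]

lemma IsC11.nonneg (hg : IsC11 M g) : 0 ≤ M := (abs_nonneg _).trans (hg.bound 0)

lemma IsC11.secondDiff_le (hg : IsC11 M g) (x h : E d) :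
    |secondDiff g x h| ≤ 4 * M * min 1 (‖h‖ ^ 2) := by
  have hM := hg.nonneg
  rcases le_total 1 (‖h‖ ^ 2) with h1 | h1
  · rw [min_eq_left h1, mul_one]; exact secondDiff_bound_of_bound hg.bound x h
  · rw [min_eq_right h1]
    refine (hg.second x h).trans ?_
    have : 0 ≤ ‖h‖ ^ 2 := by positivity
    nlinarith

lemma IsC11.abs_integrand_le (hg : IsC11 M g) (x h : E d) :
    |secondDiff g x h * levyKernel d s h| ≤ 4 * M * (min 1 (‖h‖ ^ 2) * levyKernel d s h) := by
  rw [abs_mul, abs_of_nonneg (levyKernel_nonneg h), ← mul_assoc]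
  exact mul_le_mul_of_nonneg_right (hg.secondDiff_le x h) (levyKernel_nonneg h)

lemma measurable_secondDiff (hg : Continuous g) (x : E d) : Measurable (secondDiff g x) := by
  unfold secondDiff; fun_prop

lemma IsC11.integrable (hd : 1 ≤ d) (hs0 : 0 < s) (hs1 : s < 1) (hg : IsC11 M g) (x : E d) :
    Integrable (fun h => secondDiff g x h * levyKernel d s h) :=
  ((integrable_min_levyKernel hd hs0 hs1).const_mul (4 * M)).mono'
    ((measurable_secondDiff hg.continuous x).mul measurable_levyKernel).aestronglyMeasurable
    (Eventually.of_forall fun h => by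
      rw [Real.norm_eq_abs]; exact hg.abs_integrand_le x h)

lemma IsC11.abs_symLap_le (hd : 1 ≤ d) (hs0 : 0 < s) (hs1 : s < 1) (hg : IsC11 M g) (x : E d) :
    |symLap s g x| ≤ fracConst d s / 2 * (4 * M * levyMass d s) := by
  have hc := (fracConst_pos (d := d) hs0 hs1).le
  unfold symLap
  rw [abs_mul, abs_of_nonneg (by positivity)]
  refine mul_le_mul_of_nonneg_left ?_ (by positivity)
  unfold levyMass
  rw [← integral_const_mul, ← Real.norm_eq_abs]
  refine norm_integral_le_of_norm_le ((integrable_min_levyKernel hd hs0 hs1).const_mul (4 * M))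
    (Eventually.of_forall fun h => ?_)
  rw [Real.norm_eq_abs]; exact hg.abs_integrand_le x h

/-- Pointwise convergence with uniform `C^{1,1}` bounds gives pointwise convergence of the
fractional Laplacians. -/
lemma tendsto_symLap {ι : Type*} {l : Filter ι} [l.IsCountablyGenerated] (hd : 1 ≤ d) (hs0 : 0 < s)
    (hs1 : s < 1) {f : ι → E d → ℝ} (hf : ∀ n, IsC11 M (f n))
    {x : ι → E d} {y : E d} (hlim : ∀ h, Tendsto (fun n => secondDiff (f n) (x n) h) l
      (𝓝 (secondDiff g y h))) :
    Tendsto (fun n => symLap s (f n) (x n)) l (𝓝 (symLap s g y)) := by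
  unfold symLap
  refine Tendsto.const_mul _ ?_
  refine tendsto_integral_filter_of_dominated_convergence
    (fun h => 4 * M * (min 1 (‖h‖ ^ 2) * levyKernel d s h))
    (Eventually.of_forall fun n => ((hf n).integrable hd hs0 hs1 (x n)).aestronglyMeasurable)
    (Eventually.of_forall fun n => Eventually.of_forall fun h => ?_)
    ((integrable_min_levyKernel hd hs0 hs1).const_mul (4 * M))
    (Eventually.of_forall fun h => (hlim h).mul_const _)
  rw [Real.norm_eq_abs]; exact (hf n).abs_integrand_le (x n) h

lemma IsC11.continuous_symLap (hd : 1 ≤ d) (hs0 : 0 < s) (hs1 : s < 1) (hg : IsC11 M g) :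
    Continuous (symLap s g) := by
  rw [continuous_iff_continuousAt]
  intro y
  refine tendsto_symLap (f := fun _ : E d => g) (x := id) hd hs0 hs1 (fun _ => hg) fun h => ?_
  have hc := hg.continuous
  have : Continuous fun x => secondDiff g x h := by unfold secondDiff; fun_prop
  exact this.tendsto y

lemma integrableOn_levyKernel (hd : 1 ≤ d) (hs0 : 0 < s) (hs1 : s < 1) {ε : ℝ} (hε : 0 < ε) :
    IntegrableOn (levyKernel d s) {h : E d | ε < ‖h‖} := by
  have hm : MeasurableSet {h : E d | ε < ‖h‖} := measurableSet_lt measurable_const measurable_norm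
  have h1 := ((integrable_min_levyKernel hd hs0 hs1).const_mul (min 1 (ε ^ 2))⁻¹).integrableOn
    (s := {h : E d | ε < ‖h‖})
  refine h1.mono' measurable_levyKernel.aestronglyMeasurable
    ((ae_restrict_iff' hm).2 (Eventually.of_forall fun h hh => ?_))
  rw [Real.norm_eq_abs, abs_of_nonneg (levyKernel_nonneg h), ← mul_assoc]
  have h2 : 0 < min 1 (ε ^ 2) := lt_min one_pos (by positivity)
  have h3 : min 1 (ε ^ 2) ≤ min 1 (‖h‖ ^ 2) :=
    min_le_min_left _ (pow_le_pow_left₀ hε.le (le_of_lt hh) 2)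
  refine le_mul_of_one_le_left (levyKernel_nonneg h) ?_
  rw [inv_mul_eq_div, one_le_div h2]; exact h3

/-- The truncation region is invariant under h ↦ -h, so averaging over the two signs replaces g(x) -
g(x-h) by half the second difference. The symmetrised integrand is absolutely integrable, and the
principal value becomes an ordinary limit by dominated convergence. -/
lemma IsC11.fracLaplacian_eq (hd : 1 ≤ d) (hs0 : 0 < s) (hs1 : s < 1) (hg : IsC11 M g)
    (x : E d) : fracLaplacian s g x = symLap s g x := by
  have hmeas : ∀ ε : ℝ, MeasurableSet {h : E d | ε < ‖h‖} := fun ε =>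
    measurableSet_lt measurable_const measurable_norm
  have trunc : ∀ ε : ℝ, 0 < ε →
      (∫ z in {z : E d | ε < ‖x - z‖}, (g x - g z) / ‖x - z‖ ^ ((d : ℝ) + 2 * s)) =
      2⁻¹ * ∫ h in {h : E d | ε < ‖h‖}, secondDiff g x h * levyKernel d s h := by
    intro ε hε
    have hint : ∀ σ : E d → E d, Measurable σ → IntegrableOn
        (fun h => (g x - g (σ h)) * levyKernel d s h) {h : E d | ε < ‖h‖} := by
      intro σ hσ
      refine ((integrableOn_levyKernel hd hs0 hs1 hε).const_mul (2 * M)).mono'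
        (((measurable_const.sub (hg.continuous.measurable.comp hσ)).mul
          measurable_levyKernel).aestronglyMeasurable) (Eventually.of_forall fun h => ?_)
      rw [norm_mul, Real.norm_eq_abs, Real.norm_eq_abs, abs_of_nonneg (levyKernel_nonneg h)]
      refine mul_le_mul_of_nonneg_right ?_ (levyKernel_nonneg h)
      have h1 := hg.bound x
      have h2 := hg.bound (σ h)
      exact (abs_sub _ _).trans (by linarith)
    have e1 : (∫ z in {z : E d | ε < ‖x - z‖}, (g x - g z) / ‖x - z‖ ^ ((d : ℝ) + 2 * s)) =
        ∫ h in {h : E d | ε < ‖h‖}, (g x - g (x - h)) * levyKernel d s h := by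
      have hm' : MeasurableSet {z : E d | ε < ‖x - z‖} :=
        measurableSet_lt measurable_const (by fun_prop)
      rw [← integral_indicator (hmeas ε), ← integral_indicator hm',
        ← integral_sub_left_eq_self (fun h => Set.indicator {h : E d | ε < ‖h‖}
          (fun h => (g x - g (x - h)) * levyKernel d s h) h) volume x]
      refine integral_congr_ae (Eventually.of_forall fun z => ?_)
      simp only [Set.indicator, Set.mem_ofPred_eq, levyKernel, sub_sub_cancel, div_eq_mul_inv]
    have e2 : (∫ h in {h : E d | ε < ‖h‖}, (g x - g (x - h)) * levyKernel d s h) =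
        ∫ h in {h : E d | ε < ‖h‖}, (g x - g (x + h)) * levyKernel d s h := by
      rw [← integral_indicator (hmeas ε), ← integral_indicator (hmeas ε),
        ← integral_neg_eq_self _ volume]
      refine integral_congr_ae (Eventually.of_forall fun z => ?_)
      simp only [Set.indicator, Set.mem_ofPred_eq, levyKernel_neg, norm_neg, sub_neg_eq_add]
    have e3 := integral_add (hint (fun h => x + h) (by fun_prop))
      (hint (fun h => x - h) (by fun_prop))
    have e4 : (∫ h in {h : E d | ε < ‖h‖}, secondDiff g x h * levyKernel d s h) =
        ∫ h in {h : E d | ε < ‖h‖}, ((g x - g (x + h)) * levyKernel d s h +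
          (g x - g (x - h)) * levyKernel d s h) :=
      integral_congr_ae (Eventually.of_forall fun h => by simp only [secondDiff]; ring)
    rw [e1, e4, e3, e2]; ring
  have hlim : Tendsto (fun ε : ℝ => ∫ h in {h : E d | ε < ‖h‖}, secondDiff g x h * levyKernel d s h)
      (𝓝[>] 0) (𝓝 (∫ h, secondDiff g x h * levyKernel d s h)) := by
    have hI := hg.integrable (s := s) hd hs0 hs1 x
    simp_rw [← integral_indicator (hmeas _)]
    refine tendsto_integral_filter_of_dominated_convergence _
      (Eventually.of_forall fun ε => hI.aestronglyMeasurable.indicator (hmeas ε))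
      (Eventually.of_forall fun ε => Eventually.of_forall fun h => norm_indicator_le_norm_self _ _)
      hI.norm (Eventually.of_forall fun h => ?_)
    by_cases hh : h = 0
    · subst hh
      refine tendsto_const_nhds.congr fun ε => ?_
      by_cases h0 : (0 : E d) ∈ {h : E d | ε < ‖h‖}
      · rw [Set.indicator_of_mem h0]
      · rw [Set.indicator_of_notMem h0]; simp [secondDiff]; ring_nf; simp
    · refine tendsto_const_nhds.congr' ?_
      have : Set.Ioo (0 : ℝ) ‖h‖ ∈ 𝓝[>] (0 : ℝ) := Ioo_mem_nhdsGT (norm_pos_iff.2 hh)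
      filter_upwards [this] with ε hε
      rw [Set.indicator_of_mem]; exact hε.2
  unfold fracLaplacian symLap
  have := (hlim.const_mul 2⁻¹).congr' (f₂ := fun ε : ℝ =>
      ∫ z in {z : E d | ε < ‖x - z‖}, (g x - g z) / ‖x - z‖ ^ ((d : ℝ) + 2 * s))
    (by filter_upwards [self_mem_nhdsWithin] with ε hε using (trunc ε hε).symm)
  rw [this.limUnder_eq]; ring

end C11

/-! ### The Lévy–Khintchine formula with its constant -/

section Symbol

lemma integrableOn_one_sub_exp_mul_rpow {s A : ℝ} (hs0 : 0 < s) (hs1 : s < 1) (hA : 0 < A) :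
    IntegrableOn (fun x : ℝ => (1 - Real.exp (-(A * x))) * x ^ (-s - 1)) (Set.Ioi 0) := by
  have hmeas : Measurable fun x : ℝ => (1 - Real.exp (-(A * x))) * x ^ (-s - 1) := by fun_prop
  have h0 : ∀ x : ℝ, 0 < x → 0 ≤ 1 - Real.exp (-(A * x)) := fun x hx => by
    have : Real.exp (-(A * x)) ≤ 1 := Real.exp_le_one_iff.2 (by nlinarith)
    linarith
  rw [← Set.Ioc_union_Ioi_eq_Ioi zero_le_one, integrableOn_union]
  constructor
  · have h1 : IntegrableOn (fun r : ℝ => A * r ^ (-s)) (Set.Ioc 0 1) := by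
      refine Integrable.const_mul ?_ A
      have := (intervalIntegral.intervalIntegrable_rpow' (a := 0) (b := 1)
        (show -1 < -s by linarith))
      rwa [intervalIntegrable_iff_integrableOn_Ioc_of_le zero_le_one] at this
    refine h1.mono' hmeas.aestronglyMeasurable
      ((ae_restrict_iff' measurableSet_Ioc).2 (Eventually.of_forall fun x hx => ?_))
    have hx0 : 0 < x := hx.1
    rw [Real.norm_eq_abs, abs_of_nonneg (mul_nonneg (h0 x hx0) (Real.rpow_nonneg hx0.le _))]
    have h2 : 1 - Real.exp (-(A * x)) ≤ A * x := by linarith [Real.one_sub_le_exp_neg (A * x)]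
    calc (1 - Real.exp (-(A * x))) * x ^ (-s - 1) ≤ A * x * x ^ (-s - 1) :=
          mul_le_mul_of_nonneg_right h2 (Real.rpow_nonneg hx0.le _)
      _ = A * x ^ (-s) := by
          rw [mul_assoc, ← Real.rpow_one_add' hx0.le (by linarith)]; ring_nf
  · have h1 : IntegrableOn (fun r : ℝ => r ^ (-s - 1)) (Set.Ioi 1) :=
      integrableOn_Ioi_rpow_of_lt (by linarith) zero_lt_one
    refine h1.mono' hmeas.aestronglyMeasurable
      ((ae_restrict_iff' measurableSet_Ioi).2 (Eventually.of_forall fun x hx => ?_))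
    have hx0 : 0 < x := zero_lt_one.trans hx
    rw [Real.norm_eq_abs, abs_of_nonneg (mul_nonneg (h0 x hx0) (Real.rpow_nonneg hx0.le _))]
    exact mul_le_of_le_one_left (Real.rpow_nonneg hx0.le _) (by linarith [Real.exp_pos (-(A * x))])

/-- Integration by parts against the primitive -x^{-s}/s turns this into a Gamma integral. The
boundary terms vanish at 0 because 1 - e^{-Ax} ≤ Ax and s < 1, and at infinity because s > 0. -/
lemma integral_one_sub_exp_mul_rpow {s A : ℝ} (hs0 : 0 < s) (hs1 : s < 1) (hA : 0 < A) :
    ∫ x in Set.Ioi (0 : ℝ), (1 - Real.exp (-(A * x))) * x ^ (-s - 1) =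
      A ^ s * Real.Gamma (1 - s) / s := by
  have hu : ∀ x ∈ Set.Ioi (0 : ℝ), HasDerivAt (fun x : ℝ => 1 - Real.exp (-(A * x)))
      (A * Real.exp (-(A * x))) x := fun x _ => by
    have h1 : HasDerivAt (fun x : ℝ => -(A * x)) (-A) x := by
      simpa using! ((hasDerivAt_id x).const_mul A).neg
    convert! h1.exp.const_sub 1 using 1; ring
  have hv : ∀ x ∈ Set.Ioi (0 : ℝ), HasDerivAt (fun x : ℝ => -s⁻¹ * x ^ (-s)) (x ^ (-s - 1)) x := by
    intro x hx
    have h1 := (Real.hasDerivAt_rpow_const (p := -s) (Or.inl (ne_of_gt hx))).const_mul (-s⁻¹)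
    convert! h1 using 1; field_simp
  have hgam := Real.integral_rpow_mul_exp_neg_mul_Ioi (a := 1 - s) (by linarith) hA
  have hgi : IntegrableOn (fun x : ℝ => x ^ (1 - s - 1) * Real.exp (-(A * x))) (Set.Ioi 0) := by
    -- A non-integrable function has integral 0 by convention, whereas the Gamma value is positive.
    by_contra hcon
    rw [integral_undef hcon] at hgam
    have h1 : 0 < (1 / A) ^ (1 - s) * Real.Gamma (1 - s) :=
      mul_pos (Real.rpow_pos_of_pos (by positivity) _) (Real.Gamma_pos_of_pos (by linarith))
    linarith
  have hu'v : IntegrableOn ((fun x : ℝ => A * Real.exp (-(A * x))) *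
      (fun x : ℝ => -s⁻¹ * x ^ (-s))) (Set.Ioi 0) := by
    refine IntegrableOn.congr_fun (hgi.const_mul (-s⁻¹ * A)) (fun x _ => ?_) measurableSet_Ioi
    simp only [Pi.mul_apply]
    rw [show 1 - s - 1 = -s by ring]; ring
  have hbound : ∀ x : ℝ, 0 < x → 0 ≤ 1 - Real.exp (-(A * x)) ∧ 1 - Real.exp (-(A * x)) ≤ 1 ∧
      1 - Real.exp (-(A * x)) ≤ A * x := fun x hx => by
    have : Real.exp (-(A * x)) ≤ 1 := Real.exp_le_one_iff.2 (by nlinarith)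
    exact ⟨by linarith, by linarith [Real.exp_pos (-(A * x))],
      by linarith [Real.one_sub_le_exp_neg (A * x)]⟩
  have hz : Tendsto ((fun x : ℝ => 1 - Real.exp (-(A * x))) * (fun x : ℝ => -s⁻¹ * x ^ (-s)))
      (𝓝[>] 0) (𝓝 0) := by
    have h1 : Tendsto (fun x : ℝ => s⁻¹ * A * x ^ (1 - s)) (𝓝[>] 0) (𝓝 0) := by
      have h2 : Tendsto (fun x : ℝ => x ^ (1 - s)) (𝓝[>] 0) (𝓝 0) := by
        have := (Real.continuousAt_rpow_const 0 (1 - s) (Or.inr (by linarith))).tendsto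
        rw [Real.zero_rpow (by linarith)] at this
        exact this.mono_left nhdsWithin_le_nhds
      simpa using h2.const_mul (s⁻¹ * A)
    refine squeeze_zero_norm' ?_ h1
    filter_upwards [self_mem_nhdsWithin] with x hx
    have hx0 : 0 < x := hx
    have hb := hbound x hx0
    rw [Pi.mul_apply, norm_mul, Real.norm_eq_abs, Real.norm_eq_abs, abs_of_nonneg hb.1, abs_mul,
      abs_neg, abs_of_pos (inv_pos.2 hs0), abs_of_nonneg (Real.rpow_nonneg hx0.le _)]
    calc (1 - Real.exp (-(A * x))) * (s⁻¹ * x ^ (-s)) ≤ (A * x) * (s⁻¹ * x ^ (-s)) :=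
          mul_le_mul_of_nonneg_right hb.2.2
            (mul_nonneg (inv_pos.2 hs0).le (Real.rpow_nonneg hx0.le _))
      _ = s⁻¹ * A * (x * x ^ (-s)) := by ring
      _ = s⁻¹ * A * x ^ (1 - s) := by
          rw [← Real.rpow_one_add' hx0.le (by linarith), ← sub_eq_add_neg]
  have hi : Tendsto ((fun x : ℝ => 1 - Real.exp (-(A * x))) * (fun x : ℝ => -s⁻¹ * x ^ (-s)))
      atTop (𝓝 0) := by
    have h1 : Tendsto (fun x : ℝ => s⁻¹ * x ^ (-s)) atTop (𝓝 0) := by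
      simpa using (tendsto_rpow_neg_atTop hs0).const_mul s⁻¹
    refine squeeze_zero_norm' ?_ h1
    filter_upwards [eventually_gt_atTop 0] with x hx0
    have hb := hbound x hx0
    rw [Pi.mul_apply, norm_mul, Real.norm_eq_abs, Real.norm_eq_abs, abs_of_nonneg hb.1, abs_mul,
      abs_neg, abs_of_pos (inv_pos.2 hs0), abs_of_nonneg (Real.rpow_nonneg hx0.le _)]
    exact mul_le_of_le_one_left
      (mul_nonneg (inv_pos.2 hs0).le (Real.rpow_nonneg hx0.le _)) hb.2.1
  have key := integral_Ioi_mul_deriv_eq_deriv_mul hu hv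
    (integrableOn_one_sub_exp_mul_rpow hs0 hs1 hA) hu'v hz hi
  rw [key]
  have e : (∫ x in Set.Ioi (0 : ℝ), A * Real.exp (-(A * x)) * (-s⁻¹ * x ^ (-s))) =
      -(s⁻¹ * A) * ∫ x in Set.Ioi (0 : ℝ), x ^ (1 - s - 1) * Real.exp (-(A * x)) := by
    rw [← integral_const_mul]
    refine integral_congr_ae (Eventually.of_forall fun x => ?_)
    simp only
    rw [show 1 - s - 1 = -s by ring]; ring
  rw [e, hgam, one_div, Real.inv_rpow hA.le, ← Real.rpow_neg hA.le]
  have h3 : A * A ^ (-(1 - s)) = A ^ s := by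
    rw [← Real.rpow_one_add' hA.le (by linarith)]; ring_nf
  have h4 : A ^ (-(1 - s)) = A ^ s / A := by rw [← h3]; field_simp
  rw [h4]; field_simp; ring

/-- The substitution t = 1/x reduces to the previous integral. -/
lemma integral_rpow_mul_one_sub_exp_div {s A : ℝ} (hs0 : 0 < s) (hs1 : s < 1) (hA : 0 < A) :
    ∫ t in Set.Ioi (0 : ℝ), t ^ (s - 1) * (1 - Real.exp (-(A / t))) =
      A ^ s * Real.Gamma (1 - s) / s := by
  rw [← integral_one_sub_exp_mul_rpow hs0 hs1 hA,
    ← integral_comp_rpow_Ioi (fun t => t ^ (s - 1) * (1 - Real.exp (-(A / t))))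
    (show (-1 : ℝ) ≠ 0 by norm_num)]
  refine setIntegral_congr_fun measurableSet_Ioi fun x hx => ?_
  have hx0 : (0 : ℝ) < x := hx
  simp only [smul_eq_mul, abs_neg, abs_one, one_mul]
  rw [← Real.rpow_mul hx0.le, Real.rpow_neg_one, div_inv_eq_mul, ← mul_assoc,
    ← Real.rpow_add hx0, mul_comm]
  congr 2; ring

variable {d : ℕ} {s : ℝ}

lemma integrable_gaussian {t : ℝ} (ht : 0 < t) :
    Integrable (fun h : E d => Real.exp (-(t * ‖h‖ ^ 2))) := by
  have h1 := GaussianFourier.integral_rexp_neg_mul_sq_norm (V := E d) ht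
  by_contra hcon
  have h2 : ¬ Integrable (fun v : E d => Real.exp (-t * ‖v‖ ^ 2)) := by
    simpa [neg_mul] using hcon
  rw [integral_undef h2] at h1
  have := Real.rpow_pos_of_pos (div_pos Real.pi_pos ht) (Module.finrank ℝ (E d) / 2 : ℝ)
  linarith

/-- The cosine term is the real part of the Fourier transform of a Gaussian. -/
lemma integral_one_sub_cos_mul_gaussian {t : ℝ} (ht : 0 < t) (ξ : E d) :
    ∫ h : E d, (1 - Real.cos (2 * Real.pi * inner ℝ ξ h)) * Real.exp (-(t * ‖h‖ ^ 2)) =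
      (Real.pi / t) ^ ((d : ℝ) / 2) * (1 - Real.exp (-(Real.pi ^ 2 * ‖ξ‖ ^ 2 / t))) := by
  have h1 := GaussianFourier.integral_rexp_neg_mul_sq_norm (V := E d) ht
  have h2 := GaussianFourier.integral_cexp_neg_mul_sq_norm_add (V := E d) (b := (t : ℂ))
    (by simpa using ht) (2 * Real.pi * Complex.I) ξ
  have hdim : Module.finrank ℝ (E d) = d := by simp
  rw [hdim] at h1 h2
  have hI := integrable_gaussian (d := d) ht
  have hIc : Integrable (fun h : E d => Real.cos (2 * Real.pi * inner ℝ ξ h) *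
      Real.exp (-(t * ‖h‖ ^ 2))) := by
    refine hI.mono' (by fun_prop) (Eventually.of_forall fun h => ?_)
    rw [norm_mul, Real.norm_eq_abs, Real.norm_eq_abs, abs_of_pos (Real.exp_pos _)]
    exact mul_le_of_le_one_left (Real.exp_pos _).le (Real.abs_cos_le_one _)
  have hcx : Integrable (fun v : E d => Complex.exp (-(t : ℂ) * ‖v‖ ^ 2 +
      2 * Real.pi * Complex.I * (inner ℝ ξ v : ℝ))) := by
    refine hI.mono' (by fun_prop) (Eventually.of_forall fun h => ?_)
    rw [Complex.norm_exp]
    refine le_of_eq (congrArg _ ?_)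
    simp [← Complex.ofReal_pow]
  have hre : (∫ v : E d, Complex.exp (-(t : ℂ) * ‖v‖ ^ 2 +
      2 * Real.pi * Complex.I * (inner ℝ ξ v : ℝ))).re =
      ∫ h : E d, Real.cos (2 * Real.pi * inner ℝ ξ h) * Real.exp (-(t * ‖h‖ ^ 2)) := by
    have := integral_re hcx
    simp only [RCLike.re_to_complex] at this
    rw [← this]
    refine integral_congr_ae (Eventually.of_forall fun h => ?_)
    simp only
    rw [Complex.exp_re, mul_comm]
    congr 2
    · simp [← Complex.ofReal_pow]
    · simp [← Complex.ofReal_pow]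
  have hval : (∫ h : E d, Real.cos (2 * Real.pi * inner ℝ ξ h) * Real.exp (-(t * ‖h‖ ^ 2))) =
      (Real.pi / t) ^ ((d : ℝ) / 2) * Real.exp (-(Real.pi ^ 2 * ‖ξ‖ ^ 2 / t)) := by
    rw [← hre, h2]
    have e1 : ((Real.pi : ℂ) / t) ^ ((d : ℂ) / 2) =
        (((Real.pi / t) ^ ((d : ℝ) / 2) : ℝ) : ℂ) := by
      rw [Complex.ofReal_cpow (by positivity)]; push_cast; rfl
    have e2 : Complex.exp ((2 * Real.pi * Complex.I) ^ 2 * ‖ξ‖ ^ 2 / (4 * t)) =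
        ((Real.exp (-(Real.pi ^ 2 * ‖ξ‖ ^ 2 / t)) : ℝ) : ℂ) := by
      push_cast
      congr 1
      rw [mul_pow, Complex.I_sq]; field_simp; ring
    rw [e1, e2, ← Complex.ofReal_mul, Complex.ofReal_re]
  have e3 : (∫ h : E d, (1 - Real.cos (2 * Real.pi * inner ℝ ξ h)) * Real.exp (-(t * ‖h‖ ^ 2))) =
      ∫ h : E d, (Real.exp (-(t * ‖h‖ ^ 2)) -
        Real.cos (2 * Real.pi * inner ℝ ξ h) * Real.exp (-(t * ‖h‖ ^ 2))) :=
    integral_congr_ae (Eventually.of_forall fun h => by simp only; ring)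
  have h1' : (∫ v : E d, Real.exp (-(t * ‖v‖ ^ 2))) = (Real.pi / t) ^ ((d : ℝ) / 2) := by
    simpa [neg_mul] using h1
  rw [e3, integral_sub hI hIc, hval, h1']; ring

lemma one_sub_cos_le (ξ h : E d) : 1 - Real.cos (2 * Real.pi * inner ℝ ξ h) ≤
    (2 + (2 * Real.pi * ‖ξ‖) ^ 2) * min 1 (‖h‖ ^ 2) := by
  have h0 : 0 ≤ (2 * Real.pi * ‖ξ‖) ^ 2 := by positivity
  rcases le_total 1 (‖h‖ ^ 2) with h1 | h1
  · rw [min_eq_left h1]; linarith [Real.neg_one_le_cos (2 * Real.pi * inner ℝ ξ h)]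
  · rw [min_eq_right h1]
    have h2 := Real.one_sub_sq_div_two_le_cos (x := 2 * Real.pi * inner ℝ ξ h)
    have h3 : (2 * Real.pi * inner ℝ ξ h) ^ 2 ≤ (2 * Real.pi * ‖ξ‖) ^ 2 * ‖h‖ ^ 2 := by
      have h4 := sq_le_sq' (abs_le.1 (abs_real_inner_le_norm ξ h)).1
        (abs_le.1 (abs_real_inner_le_norm ξ h)).2
      have h5 : 0 ≤ (2 * Real.pi) ^ 2 := by positivity
      calc (2 * Real.pi * inner ℝ ξ h) ^ 2 = (2 * Real.pi) ^ 2 * (inner ℝ ξ h) ^ 2 := by ring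
        _ ≤ (2 * Real.pi) ^ 2 * (‖ξ‖ * ‖h‖) ^ 2 := mul_le_mul_of_nonneg_left h4 h5
        _ = _ := by ring
    have h6 : 0 ≤ ‖h‖ ^ 2 := by positivity
    nlinarith

lemma integrable_one_sub_cos_mul_levyKernel (hd : 1 ≤ d) (hs0 : 0 < s) (hs1 : s < 1) (ξ : E d) :
    Integrable (fun h : E d =>
      (1 - Real.cos (2 * Real.pi * inner ℝ ξ h)) * levyKernel d s h) := by
  refine ((integrable_min_levyKernel hd hs0 hs1).const_mul
    (2 + (2 * Real.pi * ‖ξ‖) ^ 2)).mono' (AEStronglyMeasurable.mul (by fun_prop)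
      measurable_levyKernel.aestronglyMeasurable) (Eventually.of_forall fun h => ?_)
  have h1 : 0 ≤ 1 - Real.cos (2 * Real.pi * inner ℝ ξ h) := by
    linarith [Real.cos_le_one (2 * Real.pi * inner ℝ ξ h)]
  rw [Real.norm_eq_abs, abs_of_nonneg (mul_nonneg h1 (levyKernel_nonneg h)), ← mul_assoc]
  exact mul_le_mul_of_nonneg_right (one_sub_cos_le ξ h) (levyKernel_nonneg h)

lemma integral_gamma_levyKernel (hs0 : 0 < s) {h : E d} (hh : h ≠ 0) :
    ∫ t in Set.Ioi (0 : ℝ), t ^ (((d : ℝ) + 2 * s) / 2 - 1) * Real.exp (-(‖h‖ ^ 2 * t)) =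
      levyKernel d s h * Real.Gamma (((d : ℝ) + 2 * s) / 2) := by
  have hn : 0 < ‖h‖ := norm_pos_iff.2 hh
  rw [Real.integral_rpow_mul_exp_neg_mul_Ioi (by positivity) (by positivity), levyKernel,
    one_div, Real.inv_rpow (by positivity), ← Real.rpow_natCast, ← Real.rpow_mul hn.le]
  congr 3; push_cast; ring

/-- The Lévy–Khintchine formula for the symbol of the fractional Laplacian. -/
lemma fracConst_mul_integral_one_sub_cos (hd : 1 ≤ d) (hs0 : 0 < s) (hs1 : s < 1) (ξ : E d) :
    fracConst d s * ∫ h : E d, (1 - Real.cos (2 * Real.pi * inner ℝ ξ h)) * levyKernel d s h =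
      (2 * Real.pi * ‖ξ‖) ^ (2 * s) := by
  by_cases hξ : ξ = 0
  · subst hξ; simp [Real.zero_rpow (show 2 * s ≠ 0 by positivity)]
  have hn : 0 < ‖ξ‖ := norm_pos_iff.2 hξ
  have : Nonempty (Fin d) := ⟨⟨0, hd⟩⟩
  set β : ℝ := ((d : ℝ) + 2 * s) / 2 with hβ
  have hβ0 : 0 < β := by positivity
  have hΓ : 0 < Real.Gamma β := Real.Gamma_pos_of_pos hβ0
  -- Subordination: Γ(β)|h|^{-2β} = ∫ t^{β-1} e^{-t|h|²} dt writes the kernel as a mixture of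
  -- Gaussians, for which the h-integral is explicit. The integrand is nonnegative, so integrability
  -- on the product reduces to that of the iterated integral.
  set F : E d → ℝ → ℝ := fun h t => (1 - Real.cos (2 * Real.pi * inner ℝ ξ h)) *
    (t ^ (β - 1) * Real.exp (-(‖h‖ ^ 2 * t))) with hF
  have hcos : ∀ h : E d, 0 ≤ 1 - Real.cos (2 * Real.pi * inner ℝ ξ h) := fun h => by
    linarith [Real.cos_le_one (2 * Real.pi * inner ℝ ξ h)]
  have hFint : ∀ h : E d, h ≠ 0 → ∫ t in Set.Ioi (0 : ℝ), F h t =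
      Real.Gamma β * ((1 - Real.cos (2 * Real.pi * inner ℝ ξ h)) * levyKernel d s h) := by
    intro h hh
    simp only [hF]
    rw [integral_const_mul, integral_gamma_levyKernel hs0 hh]; ring
  have hFnn : ∀ h : E d, ∀ t ∈ Set.Ioi (0 : ℝ), 0 ≤ F h t := fun h t ht =>
    mul_nonneg (hcos h) (mul_nonneg (Real.rpow_nonneg (le_of_lt ht) _) (Real.exp_pos _).le)
  have hne : ∀ᵐ h : E d, h ≠ 0 := by
    have : (volume : Measure (E d)) {0} = 0 := measure_singleton 0
    exact compl_mem_ae_iff.2 this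
  have hmeas : Measurable (Function.uncurry F) := by
    simp only [hF, Function.uncurry_def]; fun_prop
  have hprod : Integrable (Function.uncurry F)
      ((volume : Measure (E d)).prod (volume.restrict (Set.Ioi (0 : ℝ)))) := by
    rw [integrable_prod_iff hmeas.aestronglyMeasurable]
    refine ⟨?_, ?_⟩
    · filter_upwards [hne] with h hh
      change Integrable (fun t : ℝ => (1 - Real.cos (2 * Real.pi * inner ℝ ξ h)) *
        (t ^ (β - 1) * Real.exp (-(‖h‖ ^ 2 * t)))) _
      refine Integrable.const_mul (?_ : Integrable
        (fun t : ℝ => t ^ (β - 1) * Real.exp (-(‖h‖ ^ 2 * t))) _) _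
      by_contra hcon
      have h1 := integral_gamma_levyKernel (d := d) hs0 hh
      rw [integral_undef hcon] at h1
      have h2 : 0 < levyKernel d s h := by
        unfold levyKernel; have := norm_pos_iff.2 hh; positivity
      have := mul_pos h2 hΓ
      linarith
    · refine ((integrable_one_sub_cos_mul_levyKernel hd hs0 hs1 ξ).const_mul
        (Real.Gamma β)).congr ?_
      filter_upwards [hne] with h hh
      rw [← hFint h hh]
      refine setIntegral_congr_fun measurableSet_Ioi fun t ht => ?_
      simp only [Function.uncurry_apply_pair]
      rw [Real.norm_eq_abs, abs_of_nonneg (hFnn h t ht)]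
  have hswap := integral_integral_swap hprod
  have hL : (∫ h : E d, ∫ t in Set.Ioi (0 : ℝ), F h t) = Real.Gamma β *
      ∫ h : E d, (1 - Real.cos (2 * Real.pi * inner ℝ ξ h)) * levyKernel d s h := by
    rw [← integral_const_mul]
    refine integral_congr_ae ?_
    filter_upwards [hne] with h hh using hFint h hh
  have hR : (∫ t in Set.Ioi (0 : ℝ), ∫ h : E d, F h t) =
      Real.pi ^ ((d : ℝ) / 2) * ((Real.pi ^ 2 * ‖ξ‖ ^ 2) ^ s * Real.Gamma (1 - s) / s) := by
    rw [← integral_rpow_mul_one_sub_exp_div hs0 hs1 (by positivity), ← integral_const_mul]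
    refine setIntegral_congr_fun measurableSet_Ioi fun t ht => ?_
    have ht0 : (0 : ℝ) < t := ht
    have e1 : (∫ h : E d, F h t) = t ^ (β - 1) * ∫ h : E d,
        (1 - Real.cos (2 * Real.pi * inner ℝ ξ h)) * Real.exp (-(t * ‖h‖ ^ 2)) := by
      rw [← integral_const_mul]
      refine integral_congr_ae (Eventually.of_forall fun h => ?_)
      simp only [hF]
      rw [mul_comm (‖h‖ ^ 2) t]; ring
    rw [e1, integral_one_sub_cos_mul_gaussian ht0, Real.div_rpow Real.pi_pos.le ht0.le]
    have e2 : t ^ (β - 1) / t ^ ((d : ℝ) / 2) = t ^ (s - 1) := by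
      rw [← Real.rpow_sub ht0]; congr 1; rw [hβ]; ring
    rw [← e2]; ring
  rw [hL, hR] at hswap
  have e3 : (∫ h : E d, (1 - Real.cos (2 * Real.pi * inner ℝ ξ h)) * levyKernel d s h) =
      Real.pi ^ ((d : ℝ) / 2) * ((Real.pi ^ 2 * ‖ξ‖ ^ 2) ^ s * Real.Gamma (1 - s) / s) /
        Real.Gamma β := by rw [← hswap]; field_simp
  have hΓ1 : 0 < Real.Gamma (1 - s) := Real.Gamma_pos_of_pos (by linarith)
  have hπ : 0 < Real.pi ^ ((d : ℝ) / 2) := Real.rpow_pos_of_pos Real.pi_pos _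
  have e4 : (Real.pi ^ 2 * ‖ξ‖ ^ 2) ^ s = (Real.pi * ‖ξ‖) ^ (2 * s) := by
    rw [← mul_pow, ← Real.rpow_natCast, ← Real.rpow_mul (by positivity)]; norm_num
  have e5 : (2 * Real.pi * ‖ξ‖) ^ (2 * s) = 2 ^ (2 * s) * (Real.pi * ‖ξ‖) ^ (2 * s) := by
    rw [mul_assoc, Real.mul_rpow (by norm_num) (by positivity)]
  have e6 : (2 : ℝ) ^ (2 * s - 1) = 2 ^ (2 * s) / 2 := by
    rw [Real.rpow_sub (by norm_num), Real.rpow_one]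
  rw [e3, e4, e5, fracConst, e6, ← hβ]
  field_simp

end Symbol

/-! ### From the Fourier energy to the singular integral -/

section Duality

open scoped SchwartzMap

variable {d : ℕ} {s : ℝ}

lemma rpow_le_one_add_sq {a p : ℝ} (ha : 0 ≤ a) (hp0 : 0 ≤ p) (hp : p ≤ 2) :
    a ^ p ≤ 1 + a ^ 2 := by
  rcases le_total a 1 with h | h
  · have := Real.rpow_le_one ha h hp0
    nlinarith [sq_nonneg a]
  · have := Real.rpow_le_rpow_of_exponent_le h hp
    rw [Real.rpow_two] at this
    linarith

lemma schwartz_integrable_rpow_mul (G : 𝓢(E d, ℂ)) {p : ℝ} (hp0 : 0 ≤ p) (hp : p ≤ 2) :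
    Integrable (fun ξ : E d => (((2 * Real.pi * ‖ξ‖) ^ p : ℝ) : ℂ) * G ξ) := by
  have h1 : Integrable (fun ξ : E d => ‖G ξ‖ + (2 * Real.pi) ^ 2 * (‖ξ‖ ^ 2 * ‖G ξ‖)) :=
    G.integrable.norm.add ((G.integrable_pow_mul volume 2).const_mul _)
  have hm : Measurable fun ξ : E d => (((2 * Real.pi * ‖ξ‖) ^ p : ℝ) : ℂ) := by fun_prop
  refine h1.mono' (hm.aestronglyMeasurable.mul G.continuous.aestronglyMeasurable)
    (Eventually.of_forall fun ξ => ?_)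
  have h2 : 0 ≤ 2 * Real.pi * ‖ξ‖ := by positivity
  rw [norm_mul, Complex.norm_real, Real.norm_eq_abs, abs_of_nonneg (Real.rpow_nonneg h2 _)]
  calc (2 * Real.pi * ‖ξ‖) ^ p * ‖G ξ‖ ≤ (1 + (2 * Real.pi * ‖ξ‖) ^ 2) * ‖G ξ‖ :=
        mul_le_mul_of_nonneg_right (rpow_le_one_add_sq h2 hp0 hp) (norm_nonneg _)
    _ = _ := by ring

/-- The squared modulus carries the multiplier with exponent 2p ≤ 2 and two factors of |G|, one of
which is bounded by a Schwartz seminorm. -/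
lemma schwartz_memLp_rpow_mul (G : 𝓢(E d, ℂ)) {p : ℝ} (hp0 : 0 ≤ p) (hp : p ≤ 1) :
    MemLp (fun ξ : E d => (((2 * Real.pi * ‖ξ‖) ^ p : ℝ) : ℂ) * G ξ) 2 := by
  have hm : Measurable fun ξ : E d => (((2 * Real.pi * ‖ξ‖) ^ p : ℝ) : ℂ) := by fun_prop
  have hm' : AEStronglyMeasurable (fun ξ : E d => (((2 * Real.pi * ‖ξ‖) ^ p : ℝ) : ℂ) * G ξ) :=
    hm.aestronglyMeasurable.mul G.continuous.aestronglyMeasurable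
  rw [memLp_two_iff_integrable_sq_norm hm']
  have h1 := schwartz_integrable_rpow_mul G (p := 2 * p) (by linarith) (by linarith)
  have h2 := h1.bdd_mul (f := fun ξ => G ξ) (c := SchwartzMap.seminorm ℝ 0 0 G)
    G.continuous.aestronglyMeasurable
    (Eventually.of_forall fun ξ => SchwartzMap.norm_le_seminorm ℝ G ξ)
  refine h2.norm.congr (Eventually.of_forall fun ξ => ?_)
  have h3 : 0 ≤ 2 * Real.pi * ‖ξ‖ := by positivity
  simp only [norm_mul, Complex.norm_real, Real.norm_eq_abs, abs_of_nonneg (Real.rpow_nonneg h3 _)]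
  rw [two_mul p, Real.rpow_add_of_nonneg h3 hp0 hp0]; ring

lemma continuous_fourier {v : E d → ℂ} (hv : Integrable v) : Continuous (𝓕 v) :=
  VectorFourier.fourierIntegral_continuous Real.continuous_fourierChar
    (by exact continuous_inner) hv

lemma measurable_fracSymbol {u : E d → ℝ} (hu : Integrable u) : Measurable (fracSymbol s u) := by
  have h1 : Measurable (𝓕 (fun x : E d => (u x : ℂ))) := (continuous_fourier hu.ofReal).measurable
  unfold fracSymbol
  fun_prop

lemma schwartz_inversion (F : 𝓢(E d, ℂ)) (x : E d) :
    ∫ ξ : E d, Complex.exp ((2 * Real.pi * inner ℝ ξ x : ℝ) * Complex.I) * 𝓕 F ξ = F x := by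
  have h1 : 𝓕⁻ (𝓕 F) = F := FourierTransform.fourierInv_fourier_eq F
  have h2 : (𝓕⁻ (𝓕 F)) x = F x := by rw [h1]
  rw [← h2, SchwartzMap.fourierInv_coe, Real.fourierInv_eq']
  simp only [smul_eq_mul]

/-- For Schwartz functions the multiplier `(2π|ξ|)^(2s)` gives the fractional Laplacian. -/
lemma fourierInv_symbol_eq_symLap (hd : 1 ≤ d) (hs0 : 0 < s) (hs1 : s < 1) {f : E d → ℝ}
    (F : 𝓢(E d, ℂ)) (hF : ∀ x, F x = (f x : ℂ)) (x : E d) :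
    𝓕⁻ (fun ξ : E d => (((2 * Real.pi * ‖ξ‖) ^ (2 * s) : ℝ) : ℂ) * 𝓕 F ξ) x =
      (symLap s f x : ℂ) := by
  have hc := fracConst_pos (d := d) hs0 hs1
  set e : E d → E d → ℂ := fun ξ y => Complex.exp ((2 * Real.pi * inner ℝ ξ y : ℝ) * Complex.I)
    with he
  have he1 : ∀ ξ y, ‖e ξ y‖ = 1 := fun ξ y => by simp only [he, Complex.norm_exp_ofReal_mul_I]
  have hecont : ∀ y, Continuous fun ξ => e ξ y := fun y => by simp only [he]; fun_prop
  set Ψ : E d → ℂ := fun ξ => 𝓕 F ξ with hΨ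
  have hΨc : Continuous Ψ := (𝓕 F).continuous
  have hΨi : Integrable Ψ := (𝓕 F).integrable
  have heΨ : ∀ y, Integrable fun ξ => e ξ y * Ψ ξ := fun y =>
    hΨi.bdd_mul (c := 1) (hecont y).aestronglyMeasurable
      (Eventually.of_forall fun ξ => (he1 ξ y).le)
  set q : E d → E d → ℝ := fun ξ h => (1 - Real.cos (2 * Real.pi * inner ℝ ξ h)) * levyKernel d s h
    with hq
  have hq0 : ∀ ξ h, 0 ≤ q ξ h := fun ξ h => mul_nonneg
    (by linarith [Real.cos_le_one (2 * Real.pi * inner ℝ ξ h)]) (levyKernel_nonneg h)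
  have hm : ∀ ξ, (2 * Real.pi * ‖ξ‖) ^ (2 * s) = fracConst d s * ∫ h, q ξ h := fun ξ =>
    (fracConst_mul_integral_one_sub_cos hd hs0 hs1 ξ).symm
  have hqm : Measurable (Function.uncurry q) := by
    have := measurable_levyKernel (d := d) (s := s)
    simp only [hq, Function.uncurry_def]; fun_prop
  have hqi : ∀ ξ, Integrable (q ξ) := fun ξ =>
    integrable_one_sub_cos_mul_levyKernel hd hs0 hs1 ξ
  -- Fubini is legitimate: the h-integral of `q` is (2π|ξ|)^{2s} divided by the constant, of at most
  -- quadratic growth, while `𝓕 F` is Schwartz.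
  have hprod : Integrable (Function.uncurry fun ξ h => (q ξ h : ℂ) * (e ξ x * Ψ ξ))
      ((volume : Measure (E d)).prod volume) := by
    have hmeas : AEStronglyMeasurable (Function.uncurry fun ξ h => (q ξ h : ℂ) * (e ξ x * Ψ ξ))
        ((volume : Measure (E d)).prod volume) := by
      have h1 : Measurable fun p : E d × E d => (q p.1 p.2 : ℂ) :=
        Complex.measurable_ofReal.comp hqm
      have h2 : Continuous fun p : E d × E d => e p.1 x * Ψ p.1 :=
        ((hecont x).mul hΨc).comp continuous_fst
      exact (h1.mul h2.measurable).aestronglyMeasurable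
    rw [integrable_prod_iff hmeas]
    refine ⟨Eventually.of_forall fun ξ => by
      exact (hqi ξ).ofReal.mul_const (e ξ x * Ψ ξ), ?_⟩
    have h3 := ((schwartz_integrable_rpow_mul (𝓕 F) (p := 2 * s) (by linarith)
      (by linarith)).norm).const_mul (fracConst d s)⁻¹
    refine h3.congr (Eventually.of_forall fun ξ => ?_)
    simp only [Function.uncurry_apply_pair, norm_mul, Complex.norm_real, Real.norm_eq_abs,
      abs_of_nonneg (hq0 _ _), he1, one_mul]
    rw [integral_mul_const, hm, abs_of_nonneg (mul_nonneg hc.le (integral_nonneg (hq0 ξ)))]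
    field_simp
    rfl
  have hswap := integral_integral_swap hprod
  -- With the cosine written as two exponentials, the ξ-integral is a combination of Fourier
  -- inversions at x, x+h and x-h, that is, half a second difference.
  have hinner : ∀ h, (∫ ξ, (q ξ h : ℂ) * (e ξ x * Ψ ξ)) =
      ((secondDiff f x h * levyKernel d s h / 2 : ℝ) : ℂ) := by
    intro h
    have hpt : ∀ ξ, (q ξ h : ℂ) * (e ξ x * Ψ ξ) = (levyKernel d s h / 2 : ℂ) *
        (2 * (e ξ x * Ψ ξ) - e ξ (x + h) * Ψ ξ - e ξ (x - h) * Ψ ξ) := by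
      intro ξ
      have e1 : e ξ (x + h) = e ξ x *
          Complex.exp ((2 * Real.pi * inner ℝ ξ h : ℝ) * Complex.I) := by
        simp only [he]; rw [← Complex.exp_add, inner_add_right]; congr 1; push_cast; ring
      have e2 : e ξ (x - h) = e ξ x *
          Complex.exp (-((2 * Real.pi * inner ℝ ξ h : ℝ) : ℂ) * Complex.I) := by
        simp only [he]; rw [← Complex.exp_add, inner_sub_right]; congr 1; push_cast; ring
      have e3 : (q ξ h : ℂ) = (1 - (Complex.exp ((2 * Real.pi * inner ℝ ξ h : ℝ) * Complex.I) +
          Complex.exp (-((2 * Real.pi * inner ℝ ξ h : ℝ) : ℂ) * Complex.I)) / 2) *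
          levyKernel d s h := by
        simp only [hq]
        rw [Complex.ofReal_mul, Complex.ofReal_sub, Complex.ofReal_cos, Complex.cos,
          Complex.ofReal_one]
      rw [e1, e2, e3]; ring
    simp_rw [hpt]
    have hsub : Integrable fun ξ => 2 * (e ξ x * Ψ ξ) - e ξ (x + h) * Ψ ξ :=
      ((heΨ x).const_mul 2).sub (heΨ (x + h))
    rw [integral_const_mul, integral_sub hsub (heΨ (x - h)),
      integral_sub ((heΨ x).const_mul 2) (heΨ (x + h)), integral_const_mul]
    simp only [he, hΨ]
    rw [schwartz_inversion, schwartz_inversion, schwartz_inversion, hF, hF, hF, secondDiff]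
    push_cast; ring
  rw [Real.fourierInv_eq']
  calc (∫ ξ, Complex.exp ((2 * Real.pi * inner ℝ ξ x : ℝ) * Complex.I) •
        ((((2 * Real.pi * ‖ξ‖) ^ (2 * s) : ℝ) : ℂ) * 𝓕 F ξ))
      = ∫ ξ, (fracConst d s : ℂ) * ∫ h, (q ξ h : ℂ) * (e ξ x * Ψ ξ) := by
        refine integral_congr_ae (Eventually.of_forall fun ξ => ?_)
        simp only [smul_eq_mul]
        rw [integral_mul_const, hm, integral_complex_ofReal]
        push_cast
        simp only [he, hΨ]
        push_cast; ring
    _ = (fracConst d s : ℂ) * ∫ h, ((secondDiff f x h * levyKernel d s h / 2 : ℝ) : ℂ) := by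
        rw [integral_const_mul, hswap]
        simp_rw [hinner]
    _ = (symLap s f x : ℂ) := by
        rw [integral_complex_ofReal, integral_div, symLap]; push_cast; ring

/-- The energy pairing with a Schwartz function is the pairing with its fractional Laplacian. -/
lemma fracEnergy_eq_integral (hd : 1 ≤ d) (hs0 : 0 < s) (hs1 : s < 1) {u f : E d → ℝ}
    (hu : Integrable u) (hE : hsNorm s u < ∞) (F : 𝓢(E d, ℂ)) (hF : ∀ x, F x = (f x : ℂ)) :
    fracEnergy s u f = ∫ x, u x * symLap s f x := by
  have hfF : (fun x : E d => (f x : ℂ)) = F := by ext x; rw [hF]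
  have hsym : fracSymbol s f = fun ξ => (((2 * Real.pi * ‖ξ‖) ^ s : ℝ) : ℂ) * 𝓕 F ξ := by
    ext ξ; rw [fracSymbol, hfF, SchwartzMap.fourier_coe]
  have hf2 : MemLp (fracSymbol s f) 2 (volume : Measure (E d)) := by
    rw [hsym]; exact schwartz_memLp_rpow_mul _ hs0.le hs1.le
  have hu2 : MemLp (fracSymbol s u) 2 (volume : Measure (E d)) :=
    ⟨(measurable_fracSymbol hu).aestronglyMeasurable, hE⟩
  have hG : Integrable (fun ξ : E d => (((2 * Real.pi * ‖ξ‖) ^ (2 * s) : ℝ) : ℂ) * 𝓕 F ξ) :=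
    schwartz_integrable_rpow_mul _ (by linarith) (by linarith)
  unfold fracEnergy halfFracLaplacian
  rw [dif_pos hu2, dif_pos hf2]
  -- Plancherel, after which the two multipliers of order s combine into one of order 2s on the side
  -- of `F`.
  have h1 : inner ℂ (𝓕⁻ (hu2.toLp (fracSymbol s u))) (𝓕⁻ (hf2.toLp (fracSymbol s f))) =
      inner ℂ (hu2.toLp (fracSymbol s u)) (hf2.toLp (fracSymbol s f)) :=
    (Lp.fourierTransformₗᵢ (E d) ℂ).symm.inner_map_map _ _
  rw [h1, L2.inner_def]
  have h2 : (∫ ξ, inner ℂ (hu2.toLp (fracSymbol s u) ξ) (hf2.toLp (fracSymbol s f) ξ)) =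
      ∫ ξ, (innerSL ℂ) (𝓕 (fun x : E d => (u x : ℂ)) ξ)
        ((((2 * Real.pi * ‖ξ‖) ^ (2 * s) : ℝ) : ℂ) * 𝓕 F ξ) := by
    refine integral_congr_ae ?_
    filter_upwards [hu2.coeFn_toLp, hf2.coeFn_toLp] with ξ hξ1 hξ2
    rw [hξ1, hξ2, hsym, fracSymbol]
    have h3 : 0 ≤ 2 * Real.pi * ‖ξ‖ := by positivity
    simp only [innerSL_apply_apply, RCLike.inner_apply, map_mul, Complex.conj_ofReal]
    rw [two_mul s, Real.rpow_add_of_nonneg h3 hs0.le hs0.le]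
    push_cast; ring
  -- The inverse transform now falls on the test side; this form of duality asks only that both
  -- functions be in L¹.
  have h4 := VectorFourier.integral_sesq_fourierIntegral_eq_neg_flip (innerSL ℂ)
    (L := innerₗ (E d)) (μ := volume) (ν := volume) Real.continuous_fourierChar
    (by exact continuous_inner) hu.ofReal hG
  have h5 : (∫ ξ, (innerSL ℂ) (𝓕 (fun x : E d => (u x : ℂ)) ξ)
        ((((2 * Real.pi * ‖ξ‖) ^ (2 * s) : ℝ) : ℂ) * 𝓕 F ξ)) =
      ∫ x, (innerSL ℂ) ((u x : ℂ)) (𝓕⁻ (fun ξ : E d =>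
        (((2 * Real.pi * ‖ξ‖) ^ (2 * s) : ℝ) : ℂ) * 𝓕 F ξ) x) := by
    refine h4.trans ?_
    rw [flip_innerₗ]; rfl
  rw [h2, h5]
  simp_rw [fourierInv_symbol_eq_symLap hd hs0 hs1 F hF]
  have h6 : ∀ x, (innerSL ℂ) (u x : ℂ) (symLap s f x : ℂ) = ((u x * symLap s f x : ℝ) : ℂ) := by
    intro x; simp [innerSL_apply_apply, RCLike.inner_apply, mul_comm]
  simp_rw [h6]
  rw [integral_complex_ofReal, Complex.ofReal_re]

end Duality

/-! ### Second differences and second derivatives -/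

section SecondOrder

variable {d : ℕ}

/-- Taylor bound for the centred second difference. -/
lemma secondDiff_le_of_iteratedFDeriv {g : E d → ℝ} (hg : ContDiff ℝ 2 g) {x h : E d} {B : ℝ}
    (hB : ∀ y, ‖y - x‖ ≤ ‖h‖ → ‖iteratedFDeriv ℝ 2 g y‖ ≤ B) :
    |secondDiff g x h| ≤ 2 * B * ‖h‖ ^ 2 := by
  have hdiff : Differentiable ℝ g := hg.differentiable (by norm_num)
  have hdiff2 : Differentiable ℝ (fderiv ℝ g) :=
    (hg.fderiv_right (m := 1) (by norm_num)).differentiable (by norm_num)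
  have hnorm : ∀ y, ‖fderiv ℝ (fderiv ℝ g) y‖ = ‖iteratedFDeriv ℝ 2 g y‖ := fun y => by
    rw [← norm_iteratedFDeriv_one, norm_iteratedFDeriv_fderiv]
  have hconv : Convex ℝ (Metric.closedBall x ‖h‖) := convex_closedBall x ‖h‖
  have hx : x ∈ Metric.closedBall x ‖h‖ := Metric.mem_closedBall_self (norm_nonneg h)
  have hB0 : 0 ≤ B := (norm_nonneg _).trans (hB x (by simp))
  have h1 : ∀ y ∈ Metric.closedBall x ‖h‖, ‖fderiv ℝ g y - fderiv ℝ g x‖ ≤ B * ‖h‖ := by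
    intro y hy
    have h2 := hconv.norm_image_sub_le_of_norm_fderiv_le (𝕜 := ℝ) (f := fderiv ℝ g) (C := B)
      (fun z _ => hdiff2 z)
      (fun z hz => by rw [hnorm]; exact hB z (by rwa [← dist_eq_norm])) hx hy
    refine h2.trans (mul_le_mul_of_nonneg_left ?_ hB0)
    rwa [← dist_eq_norm]
  -- The linear terms for h and -h cancel in the second difference, so two first-order Taylor
  -- remainders of size B|h|² are all that is left.
  have h3 : ∀ k : E d, ‖k‖ = ‖h‖ → |g (x + k) - g x - fderiv ℝ g x k| ≤ B * ‖h‖ * ‖h‖ := by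
    intro k hk
    have hy : x + k ∈ Metric.closedBall x ‖h‖ := by simp [dist_eq_norm, hk]
    have h4 := hconv.norm_image_sub_le_of_norm_fderiv_le' (𝕜 := ℝ) (f := g) (C := B * ‖h‖)
      (φ := fderiv ℝ g x) (fun z _ => hdiff z) h1 hx hy
    rwa [add_sub_cancel_left, hk, Real.norm_eq_abs] at h4
  have h5 := abs_le.1 (h3 h rfl)
  have h6 := abs_le.1 (h3 (-h) (norm_neg h))
  rw [map_neg, ← sub_eq_add_neg] at h6
  unfold secondDiff
  rw [abs_le]
  constructor <;> nlinarith [h5.1, h5.2, h6.1, h6.2]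

lemma exists_isC11 {g : E d → ℝ} (hg : ContDiff ℝ 2 g) {A B : ℝ} (hA : ∀ x, |g x| ≤ A)
    (hB : ∀ x, ‖iteratedFDeriv ℝ 2 g x‖ ≤ B) : ∃ M, IsC11 M g := by
  refine ⟨max A (2 * B), hg.continuous, fun x => (hA x).trans (le_max_left _ _), fun x h => ?_⟩
  exact (secondDiff_le_of_iteratedFDeriv hg fun y _ => hB y).trans
    (mul_le_mul_of_nonneg_right (le_max_right _ _) (by positivity))

lemma exists_isC11_of_hasCompactSupport {g : E d → ℝ} (hg : ContDiff ℝ 2 g)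
    (hc : HasCompactSupport g) : ∃ M, IsC11 M g := by
  obtain ⟨A, hA⟩ := hc.exists_bound_of_continuous hg.continuous
  obtain ⟨B, hB⟩ := (hc.iteratedFDeriv (𝕜 := ℝ) 2).exists_bound_of_continuous
    (hg.continuous_iteratedFDeriv (m := 2) le_rfl)
  exact exists_isC11 hg hA hB

lemma symLap_const_mul (s : ℝ) (c : ℝ) (g : E d → ℝ) (x : E d) :
    symLap s (fun y => c * g y) x = c * symLap s g x := by
  unfold symLap
  have : ∀ h, secondDiff (fun y => c * g y) x h * levyKernel d s h =
      c * (secondDiff g x h * levyKernel d s h) := fun h => by simp only [secondDiff]; ring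
  simp_rw [this, integral_const_mul]
  ring

end SecondOrder

/-! ### From a weak time derivative to the integrated identity -/

section WeakDerivative

/-- The normalised bump functions `(shrinkingBump V n)` have support in the ball of radius
`1/(n+1)`. -/
def shrinkingBump (V : Type*) [NormedAddCommGroup V] (n : ℕ) : ContDiffBump (0 : V) where
  rIn := 1 / (n + 1) / 2
  rOut := 1 / (n + 1)
  rIn_pos := by positivity
  rIn_lt_rOut := half_lt_self (by positivity)

lemma tendsto_shrinkingBump_rOut (V : Type*) [NormedAddCommGroup V] :
    Tendsto (fun n => (shrinkingBump V n).rOut) atTop (𝓝 0) :=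
  tendsto_one_div_add_atTop_nhds_zero_nat

open scoped Convolution

lemma abs_normed_convolution_le {V : Type*} [NormedAddCommGroup V] [InnerProductSpace ℝ V]
    [FiniteDimensional ℝ V] [MeasurableSpace V] [BorelSpace V] (φ : ContDiffBump (0 : V))
    {g : V → ℝ} {M : ℝ} (hM : ∀ x, |g x| ≤ M) (x : V) :
    |(φ.normed volume ⋆[ContinuousLinearMap.lsmul ℝ ℝ, volume] g) x| ≤ M := by
  rw [convolution_def]
  have h1 : Integrable fun t => φ.normed volume t * M := φ.integrable_normed.mul_const M
  have h2 := norm_integral_le_of_norm_le (μ := (volume : Measure V))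
    (f := fun t => ContinuousLinearMap.lsmul ℝ ℝ (φ.normed volume t) (g (x - t))) h1
    (Eventually.of_forall fun t => by
      simp only [ContinuousLinearMap.lsmul_apply, smul_eq_mul, norm_mul, Real.norm_eq_abs,
        abs_of_nonneg (φ.nonneg_normed t)]
      exact mul_le_mul_of_nonneg_left (hM _) (φ.nonneg_normed t))
  rwa [integral_mul_const, φ.integral_normed, one_mul, Real.norm_eq_abs] at h2

/-- A continuous function on `(0,T)` with continuous weak derivative `-G` satisfies the
fundamental theorem of calculus. -/
lemma sub_eq_neg_integral_of_weak_deriv {T : ℝ} {F G : ℝ → ℝ} (hF : ContinuousOn F (Set.Ioc 0 T))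
    (hG : ContinuousOn G (Set.Ioc 0 T))
    (hw : ∀ θ : ℝ → ℝ, ContDiff ℝ 1 θ → HasCompactSupport θ → tsupport θ ⊆ Set.Ioo 0 T →
      ∫ t in Set.Ioo 0 T, deriv θ t * F t = ∫ t in Set.Ioo 0 T, θ t * G t)
    {a b : ℝ} (ha : 0 < a) (hab : a ≤ b) (hb : b < T) :
    F b - F a = -∫ t in a..b, G t := by
  set a' := a / 2 with ha'
  set b' := (b + T) / 2 with hb'
  have haa : a' < a := by rw [ha']; linarith
  have hbb : b < b' := by rw [hb']; linarith
  have hbT : b' < T := by rw [hb']; linarith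
  have ha0 : 0 < a' := by rw [ha']; linarith
  have hab' : a' ≤ b' := by linarith
  have hsub : Set.Icc a' b' ⊆ Set.Ioc 0 T := fun t ht => ⟨ha0.trans_le ht.1, ht.2.trans hbT.le⟩
  have hsub' : Set.Icc a' b' ⊆ Set.Ioo 0 T := fun t ht => ⟨ha0.trans_le ht.1, ht.2.trans_lt hbT⟩
  -- `F'` and `G'` are continuous extensions from [a',b'] to the line, not derivatives. The margin
  -- between [a,b] and [a',b'] leaves room for the mollifier.
  set F' : ℝ → ℝ := Set.IccExtend hab' ((Set.Icc a' b').domRestrict F) with hF'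
  set G' : ℝ → ℝ := Set.IccExtend hab' ((Set.Icc a' b').domRestrict G) with hG'
  have hF'c : Continuous F' := 
    continuous_IccExtend_iff.2 (continuousOn_iff_continuous_domRestrict.1 (hF.mono hsub))
  have hG'c : Continuous G' := 
    continuous_IccExtend_iff.2 (continuousOn_iff_continuous_domRestrict.1 (hG.mono hsub))
  have hF'e : ∀ t ∈ Set.Icc a' b', F' t = F t := fun t ht => by
    simp [hF', Set.domRestrict, Set.IccExtend_of_mem hab' _ ht]
  have hG'e : ∀ t ∈ Set.Icc a' b', G' t = G t := fun t ht => by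
    simp [hG', Set.domRestrict, Set.IccExtend_of_mem hab' _ ht]
  obtain ⟨M, hM⟩ : ∃ M, ∀ t, |G' t| ≤ M := by
    obtain ⟨M, hM⟩ := isCompact_Icc.exists_bound_of_continuousOn (hG.mono hsub)
    exact ⟨M, fun t => hM _ (Subtype.coe_prop (Set.projIcc a' b' hab' t))⟩
  set ρ : ℕ → ℝ → ℝ := fun n => (shrinkingBump ℝ n).normed volume with hρ
  have hρd : ∀ n, ContDiff ℝ 1 (ρ n) := fun n => (shrinkingBump ℝ n).contDiff_normed (n := 1)
  have hρc : ∀ n, HasCompactSupport (ρ n) := fun n => (shrinkingBump ℝ n).hasCompactSupport_normed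
  have hlim : ∀ {H : ℝ → ℝ}, Continuous H → ∀ x, Tendsto
      (fun n => (ρ n ⋆[ContinuousLinearMap.lsmul ℝ ℝ, volume] H) x) atTop (𝓝 (H x)) :=
    fun hH x => ContDiffBump.convolution_tendsto_right_of_continuous
      (tendsto_shrinkingBump_rOut ℝ) hH x
  -- Testing with θ(τ) = ρ_n(x-τ) gives a classical derivative for the mollified function. The minus
  -- sign comes from θ' = -ρ_n'(x-·).
  have hder : ∀ n, (shrinkingBump ℝ n).rOut < a - a' → (shrinkingBump ℝ n).rOut < b' - b →
      ∀ x ∈ Set.Icc a b, (deriv (ρ n) ⋆[ContinuousLinearMap.lsmul ℝ ℝ, volume] F') x =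
        -(ρ n ⋆[ContinuousLinearMap.lsmul ℝ ℝ, volume] G') x := by
    intro n h1 h2 x hx
    set θ : ℝ → ℝ := fun τ => ρ n (x - τ) with hθ
    have hsupp : ∀ τ, τ ∉ Set.Icc a' b' →
        x - τ ∉ Metric.closedBall (0 : ℝ) (shrinkingBump ℝ n).rOut := by
      intro τ hτ hmem
      rw [mem_closedBall_zero_iff, Real.norm_eq_abs, abs_le] at hmem
      exact hτ ⟨by linarith [hx.1], by linarith [hx.2]⟩
    have hts : tsupport (ρ n) = Metric.closedBall (0 : ℝ) (shrinkingBump ℝ n).rOut :=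
      (shrinkingBump ℝ n).tsupport_normed_eq
    have hρ0 : ∀ τ, τ ∉ Set.Icc a' b' → ρ n (x - τ) = 0 := fun τ hτ =>
      image_eq_zero_of_notMem_tsupport (by rw [hts]; exact hsupp τ hτ)
    have hρ0' : ∀ τ, τ ∉ Set.Icc a' b' → deriv (ρ n) (x - τ) = 0 := fun τ hτ =>
      image_eq_zero_of_notMem_tsupport fun hmem => hsupp τ hτ (by
        rw [← hts]; exact tsupport_deriv_subset hmem)
    have hθts : tsupport θ ⊆ Set.Icc a' b' :=
      closure_minimal (fun τ hτ => by
        by_contra hcon; exact hτ (hρ0 τ hcon)) isClosed_Icc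
    have hθd : ContDiff ℝ 1 θ := (hρd n).comp (contDiff_const.sub contDiff_id)
    have hθder : ∀ τ, deriv θ τ = -deriv (ρ n) (x - τ) := fun τ => by
      simp only [hθ]; rw [deriv_comp_const_sub]
    have hθc : HasCompactSupport θ :=
      HasCompactSupport.of_support_subset_isCompact isCompact_Icc
        (subset_closure.trans hθts)
    have key := hw θ hθd hθc (hθts.trans hsub')
    have red : ∀ {p H H' : ℝ → ℝ}, (∀ τ, τ ∉ Set.Icc a' b' → p τ = 0) →
        (∀ t ∈ Set.Icc a' b', H' t = H t) →
        ∫ t in Set.Ioo 0 T, p t * H t = ∫ t, p t * H' t := by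
      intro p H H' hp hH
      rw [← setIntegral_eq_integral_of_forall_compl_eq_zero (s := Set.Ioo 0 T)
        (f := fun t => p t * H' t)]
      · refine setIntegral_congr_fun measurableSet_Ioo fun t _ => ?_
        by_cases ht : t ∈ Set.Icc a' b'
        · simp only [hH t ht]
        · simp only [hp t ht, zero_mul]
      · intro t ht
        rw [hp t fun h => ht (hsub' h), zero_mul]
    rw [red (H' := F') (fun τ hτ => by rw [hθder, hρ0' τ hτ, neg_zero]) hF'e,
      red (H' := G') hρ0 hG'e] at key
    rw [convolution_eq_swap, convolution_eq_swap]
    simp only [ContinuousLinearMap.lsmul_apply, smul_eq_mul]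
    simp only [hθder, neg_mul, integral_neg] at key
    rw [← key, neg_neg]
  have hFTC : ∀ᶠ n in atTop, (ρ n ⋆[ContinuousLinearMap.lsmul ℝ ℝ, volume] F') b -
      (ρ n ⋆[ContinuousLinearMap.lsmul ℝ ℝ, volume] F') a =
      ∫ t in a..b, -(ρ n ⋆[ContinuousLinearMap.lsmul ℝ ℝ, volume] G') t := by
    have e1 := (tendsto_shrinkingBump_rOut ℝ).eventually_lt_const (sub_pos.2 haa)
    have e2 := (tendsto_shrinkingBump_rOut ℝ).eventually_lt_const (sub_pos.2 hbb)
    filter_upwards [e1, e2] with n h1 h2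
    symm
    refine intervalIntegral.integral_eq_sub_of_hasDerivAt (fun x hx => ?_)
      (((hρc n).continuous_convolution_left _ (hρd n).continuous
        hG'c.locallyIntegrable).neg.intervalIntegrable _ _)
    rw [Set.uIcc_of_le hab] at hx
    have h3 := (hρc n).hasDerivAt_convolution_left (ContinuousLinearMap.lsmul ℝ ℝ) (hρd n)
      (hF'c.locallyIntegrable (μ := volume)) x
    rwa [hder n h1 h2 x hx] at h3
  have hlimL : Tendsto (fun n => (ρ n ⋆[ContinuousLinearMap.lsmul ℝ ℝ, volume] F') b -
      (ρ n ⋆[ContinuousLinearMap.lsmul ℝ ℝ, volume] F') a) atTop (𝓝 (F' b - F' a)) :=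
    (hlim hF'c b).sub (hlim hF'c a)
  have hlimR : Tendsto (fun n => ∫ t in a..b,
      -(ρ n ⋆[ContinuousLinearMap.lsmul ℝ ℝ, volume] G') t) atTop (𝓝 (∫ t in a..b, -G' t)) := by
    refine intervalIntegral.tendsto_integral_filter_of_dominated_convergence (fun _ => M)
      (Eventually.of_forall fun n => ?_) (Eventually.of_forall fun n => ?_)
      intervalIntegrable_const ?_
    · exact ((hρc n).continuous_convolution_left _ (hρd n).continuous
        hG'c.locallyIntegrable).neg.aestronglyMeasurable
    · refine Eventually.of_forall fun x _ => ?_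
      rw [norm_neg, Real.norm_eq_abs]
      exact abs_normed_convolution_le _ hM x
    · exact Eventually.of_forall fun x _ => (hlim hG'c x).neg
  have huniq := tendsto_nhds_unique (hlimL.congr' hFTC) hlimR
  rw [hF'e b ⟨by linarith, hbb.le⟩, hF'e a ⟨haa.le, by linarith⟩,
    intervalIntegral.integral_neg] at huniq
  rw [huniq]
  congr 1
  refine intervalIntegral.integral_congr fun t ht => ?_
  rw [Set.uIcc_of_le hab] at ht
  exact hG'e t ⟨haa.le.trans ht.1, ht.2.trans hbb.le⟩

end WeakDerivative

/-! ### Pairings of the solution with test functions -/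

section Pairing

variable {d : ℕ} {s T M : ℝ} {u : ℝ → E d → ℝ}

lemma integrable_mul_of_bound {v g : E d → ℝ} (hv : Integrable v) (hg : Continuous g)
    (hM : ∀ x, |g x| ≤ M) : Integrable fun x => v x * g x :=
  hv.mul_bdd (c := M) hg.aestronglyMeasurable (Eventually.of_forall hM)

lemma abs_integral_mul_sub_le {v w g : E d → ℝ} (hv : Integrable v) (hw : Integrable w)
    (hg : Continuous g) (hM : ∀ x, |g x| ≤ M) :
    |(∫ x, v x * g x) - ∫ x, w x * g x| ≤ M * (∫⁻ x, ‖v x - w x‖ₑ).toReal := by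
  rw [← integral_sub (integrable_mul_of_bound hv hg hM) (integrable_mul_of_bound hw hg hM),
    ← integral_norm_eq_lintegral_enorm (f := fun x => v x - w x)
      (hv.sub hw).aestronglyMeasurable, ← integral_const_mul,
    ← Real.norm_eq_abs]
  refine norm_integral_le_of_norm_le ((hv.sub hw).norm.const_mul M)
    (Eventually.of_forall fun x => ?_)
  rw [← sub_mul, norm_mul, mul_comm, Real.norm_eq_abs (g x)]
  exact mul_le_mul_of_nonneg_right (hM x) (norm_nonneg _)

lemma IsWeakSolution.continuousOn_pairing (hu : IsWeakSolution s T u) {g : E d → ℝ}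
    (hg : Continuous g) (hM : ∀ x, |g x| ≤ M) :
    ContinuousOn (fun t => ∫ x, u t x * g x) (Set.Ioc 0 T) := by
  intro t₀ ht₀
  have h1 := (ENNReal.tendsto_toReal ENNReal.zero_ne_top).comp (hu.continuous_L1 t₀ ht₀)
  have h2 := h1.const_mul M
  rw [ENNReal.toReal_zero, mul_zero] at h2
  rw [ContinuousWithinAt, tendsto_iff_dist_tendsto_zero]
  refine squeeze_zero' (Eventually.of_forall fun _ => dist_nonneg) ?_ h2
  filter_upwards [self_mem_nhdsWithin] with t ht
  rw [Real.dist_eq]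
  exact abs_integral_mul_sub_le (hu.integrable t ht) (hu.integrable t₀ ht₀) hg hM

lemma norm_fourier_sub_le {v w : E d → ℝ} (hv : Integrable v) (hw : Integrable w) (ξ : E d) :
    ‖𝓕 (fun x : E d => (v x : ℂ)) ξ - 𝓕 (fun x : E d => (w x : ℂ)) ξ‖ ≤
      (∫⁻ x, ‖v x - w x‖ₑ).toReal := by
  rw [← integral_norm_eq_lintegral_enorm (f := fun x => v x - w x)
      (hv.sub hw).aestronglyMeasurable, Real.fourier_eq,
    Real.fourier_eq, ← integral_sub]
  · refine norm_integral_le_of_norm_le (hv.sub hw).norm (Eventually.of_forall fun x => ?_)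
    rw [← smul_sub, Circle.norm_smul, ← Complex.ofReal_sub, Complex.norm_real]
  · exact (Real.fourierIntegral_convergent_iff ξ).2 hv.ofReal
  · exact (Real.fourierIntegral_convergent_iff ξ).2 hw.ofReal

/-- Outside these times `halfFracLaplacian` takes its default value 0 and the energy carries no
information. A finite lower integral gives finiteness almost everywhere only for a measurable
integrand, so most of the proof is measurability in time. -/
lemma IsWeakSolution.ae_hsNorm_lt_top (hu : IsWeakSolution s T u) :
    ∀ᵐ t ∂(volume.restrict (Set.Ioo 0 T)), hsNorm s (u t) < ∞ := by
  have hIcc : ∀ a b : ℝ, 0 < a → b < T →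
      ∀ᵐ t ∂(volume.restrict (Set.Icc a b)), hsNorm s (u t) < ∞ := by
    intro a b ha hb
    rcases le_or_gt a b with hab | hab
    swap
    · simp [Set.Icc_eq_empty (not_le.2 hab)]
    -- Projecting time to [a,b] makes `u (p t)` integrable for every real t. Its Fourier transform
    -- is then continuous in t and measurable in ξ, hence jointly measurable.
    set p : ℝ → ℝ := fun t => (Set.projIcc a b hab t : ℝ) with hp
    have hpm : ∀ t, p t ∈ Set.Ioc 0 T := fun t => by
      have := (Set.projIcc a b hab t).2
      exact ⟨ha.trans_le this.1, this.2.trans hb.le⟩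
    have hpc : Continuous p := continuous_subtype_val.comp continuous_projIcc
    have hpe : ∀ t ∈ Set.Icc a b, p t = t := fun t ht => by
      simp [hp, Set.projIcc_of_mem hab ht]
    have hmeas : Measurable (Function.uncurry fun (t : ℝ) (ξ : E d) =>
        𝓕 (fun x : E d => (u (p t) x : ℂ)) ξ) := by
      refine measurable_uncurry_of_continuous_of_measurable (fun ξ => ?_) (fun t =>
        (continuous_fourier (hu.integrable _ (hpm t)).ofReal).measurable)
      rw [continuous_iff_continuousAt]
      intro t₀
      have h1 := (ENNReal.tendsto_toReal ENNReal.zero_ne_top).comp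
        (hu.continuous_L1 (p t₀) (hpm t₀))
      rw [ENNReal.toReal_zero] at h1
      have h2 : Tendsto p (𝓝 t₀) (𝓝[Set.Ioc 0 T] (p t₀)) :=
        tendsto_nhdsWithin_iff.2 ⟨hpc.tendsto t₀, Eventually.of_forall hpm⟩
      rw [ContinuousAt, tendsto_iff_norm_sub_tendsto_zero]
      exact squeeze_zero (fun _ => norm_nonneg _)
        (fun t => norm_fourier_sub_le (hu.integrable _ (hpm t)) (hu.integrable _ (hpm t₀)) ξ)
        (h1.comp h2)
    have hmeas2 : Measurable fun t => hsNorm s (u (p t)) := by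
      have h0 : ∀ t, hsNorm s (u (p t)) =
          (∫⁻ ξ, ‖fracSymbol s (u (p t)) ξ‖ₑ ^ (2 : ℝ)) ^ (1 / (2 : ℝ)) := fun t => by
        rw [hsNorm, eLpNorm_eq_lintegral_rpow_enorm_toReal (by norm_num) (by norm_num)]
        simp
      simp_rw [h0]
      refine Measurable.pow_const (Measurable.lintegral_prod_right'
        (f := fun q : ℝ × E d => ‖fracSymbol s (u (p q.1)) q.2‖ₑ ^ (2 : ℝ)) ?_) _
      have h3 : Measurable fun q : ℝ × E d => fracSymbol s (u (p q.1)) q.2 := by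
        unfold fracSymbol
        refine Measurable.mul ?_ hmeas
        fun_prop
      exact h3.enorm.pow_const _
    have hfin : ∫⁻ t in Set.Icc a b, hsNorm s (u (p t)) ^ 2 < ∞ := by
      refine lt_of_eq_of_lt ?_ (hu.energy a b ha hb)
      exact setLIntegral_congr_fun measurableSet_Icc fun t ht => by simp only [hpe t ht]
    have h4 := ae_lt_top (hmeas2.pow_const 2) hfin.ne
    filter_upwards [h4, ae_restrict_mem measurableSet_Icc] with t ht htm
    rw [hpe t htm] at ht
    by_contra hcon
    rw [not_lt_top_iff] at hcon
    simp [hcon] at ht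
  have hcover : Set.Ioo 0 T ⊆ ⋃ n : ℕ, Set.Icc (1 / ((n : ℝ) + 1)) (T - 1 / ((n : ℝ) + 1)) := by
    intro t ht
    obtain ⟨n, hn⟩ := exists_nat_one_div_lt (lt_min ht.1 (sub_pos.2 ht.2))
    rw [lt_min_iff] at hn
    exact Set.mem_iUnion.2 ⟨n, hn.1.le, by linarith [hn.2]⟩
  refine ae_restrict_of_ae_restrict_of_subset hcover (ae_restrict_iUnion_iff _ _ |>.2 fun n => ?_)
  have : (0 : ℝ) < 1 / ((n : ℝ) + 1) := by positivity
  exact hIcc _ _ this (by linarith)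

/-- The integrated equation tested with a smooth compactly supported function. -/
lemma IsWeakSolution.sub_eq_of_smooth (hd : 1 ≤ d) (hs0 : 0 < s) (hs1 : s < 1)
    (hu : IsWeakSolution s T u) {f : E d → ℝ} (hf : ContDiff ℝ (↑(⊤ : ℕ∞)) f)
    (hfc : HasCompactSupport f) {a b : ℝ} (ha : 0 < a) (hab : a ≤ b) (hb : b < T) :
    (∫ x, u b x * f x) - (∫ x, u a x * f x) = -∫ t in a..b, ∫ x, u t x * symLap s f x := by
  obtain ⟨M, hM⟩ := exists_isC11_of_hasCompactSupport (contDiff_infty.1 hf 2) hfc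
  refine sub_eq_neg_integral_of_weak_deriv (T := T) (F := fun t => ∫ x, u t x * f x)
    (G := fun t => ∫ x, u t x * symLap s f x)
    (hu.continuousOn_pairing hM.continuous hM.bound)
    (hu.continuousOn_pairing (hM.continuous_symLap hd hs0 hs1) (hM.abs_symLap_le hd hs0 hs1))
    (fun θ hθ hθc hθs => ?_) ha hab hb
  have hsub : tsupport (fun p : ℝ × E d => θ p.1 * f p.2) ⊆ tsupport θ ×ˢ tsupport f :=
    closure_minimal (fun p hp => by
      have hp' : θ p.1 * f p.2 ≠ 0 := hp
      exact ⟨subset_tsupport _ (left_ne_zero_of_mul hp'),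
        subset_tsupport _ (right_ne_zero_of_mul hp')⟩)
      ((isClosed_tsupport _).prod (isClosed_tsupport _))
  -- A product test function θ(t)f(x) reduces the equation to a scalar weak derivative for the
  -- pairing with f.
  have key := hu.weak_eq (fun p => θ p.1 * f p.2)
    ((hθ.comp contDiff_fst).mul ((contDiff_infty.1 hf 1).comp contDiff_snd))
    (HasCompactSupport.of_support_subset_isCompact (hθc.isCompact.prod hfc.isCompact)
      ((subset_tsupport _).trans hsub))
    (hsub.trans fun p hp => ⟨hθs hp.1, trivial⟩)
  have e1 : (∫ t in Set.Ioo 0 T, ∫ x, u t x * deriv (fun τ => θ τ * f x) t) =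
      ∫ t in Set.Ioo 0 T, deriv θ t * ∫ x, u t x * f x := by
    refine integral_congr_ae (Eventually.of_forall fun t => ?_)
    simp only
    rw [← integral_const_mul]
    refine integral_congr_ae (Eventually.of_forall fun x => ?_)
    simp only
    rw [deriv_mul_const ((hθ.differentiable one_ne_zero) t)]; ring
  have e2 : (∫ t in Set.Ioo 0 T, fracEnergy s (u t) (fun x => θ t * f x)) =
      ∫ t in Set.Ioo 0 T, θ t * ∫ x, u t x * symLap s f x := by
    refine integral_congr_ae ?_
    filter_upwards [hu.ae_hsNorm_lt_top, ae_restrict_mem measurableSet_Ioo] with t ht htm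
    have hc' : HasCompactSupport fun x => ((θ t * f x : ℝ) : ℂ) :=
      (hfc.mul_left (f := fun _ => θ t)).comp_left Complex.ofReal_zero
    have hd' : ContDiff ℝ (↑(⊤ : ℕ∞)) fun x => ((θ t * f x : ℝ) : ℂ) :=
      Complex.ofRealCLM.contDiff.comp (contDiff_const.mul hf)
    rw [fracEnergy_eq_integral hd hs0 hs1 (hu.integrable t ⟨htm.1, htm.2.le⟩) ht
      (hc'.toSchwartzMap hd') (fun x => rfl), ← integral_const_mul]
    refine integral_congr_ae (Eventually.of_forall fun x => ?_)
    simp only [symLap_const_mul]; ring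
  simp only at key
  rw [e1, e2, sub_eq_zero] at key
  exact key

end Pairing

/-! ### Test functions without compact support -/

section Approximation

open scoped Convolution

variable {d : ℕ}

/-- Interpolation of Landau type: over a unit step k the Taylor formula gives |Dg(x)k| ≤ |g(x+k) -
g(x)| + B ≤ 2A + B. -/
lemma exists_lipschitz_of_contDiff {g : E d → ℝ} (hg : ContDiff ℝ 2 g) {A B : ℝ}
    (hA : ∀ x, |g x| ≤ A) (hB : ∀ x, ‖iteratedFDeriv ℝ 2 g x‖ ≤ B) :
    ∃ L, 0 ≤ L ∧ ∀ x y, |g x - g y| ≤ L * ‖x - y‖ := by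
  have hdiff : Differentiable ℝ g := hg.differentiable (by norm_num)
  have hA0 : 0 ≤ A := (abs_nonneg _).trans (hA 0)
  have hB0 : 0 ≤ B := (norm_nonneg _).trans (hB 0)
  have hdiff2 : Differentiable ℝ (fderiv ℝ g) :=
    (hg.fderiv_right (m := 1) (by norm_num)).differentiable (by norm_num)
  have hnorm : ∀ y, ‖fderiv ℝ (fderiv ℝ g) y‖ ≤ B := fun y => by
    rw [← norm_iteratedFDeriv_one, norm_iteratedFDeriv_fderiv]; exact hB y
  have h1 : ∀ x y, ‖fderiv ℝ g y - fderiv ℝ g x‖ ≤ B * ‖y - x‖ := fun x y =>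
    convex_univ.norm_image_sub_le_of_norm_fderiv_le (𝕜 := ℝ) (f := fderiv ℝ g)
      (fun z _ => hdiff2 z) (fun z _ => hnorm z) trivial trivial
  have h2 : ∀ x, ‖fderiv ℝ g x‖ ≤ B + 2 * A := by
    intro x
    refine ContinuousLinearMap.opNorm_le_of_unit_norm (by linarith) fun k hk => ?_
    have h3 := (convex_closedBall x 1).norm_image_sub_le_of_norm_fderiv_le' (𝕜 := ℝ) (f := g)
      (C := B) (φ := fderiv ℝ g x) (y := x + k) (fun z _ => hdiff z)
      (fun z hz => (h1 x z).trans (mul_le_of_le_one_right hB0 (by rwa [← dist_eq_norm])))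
      (Metric.mem_closedBall_self zero_le_one) (by simp [dist_eq_norm, hk])
    rw [add_sub_cancel_left, hk, mul_one, Real.norm_eq_abs] at h3
    have h4 := abs_le.1 h3
    have h5 := abs_le.1 (hA x)
    have h6 := abs_le.1 (hA (x + k))
    rw [Real.norm_eq_abs, abs_le]
    constructor <;> linarith [h4.1, h4.2, h5.1, h5.2, h6.1, h6.2]
  refine ⟨B + 2 * A, by linarith, fun x y => ?_⟩
  have := convex_univ.norm_image_sub_le_of_norm_fderiv_le (𝕜 := ℝ) (f := g)
      (fun z _ => hdiff z) (fun z _ => h2 z) (Set.mem_univ y) (Set.mem_univ x)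
  rwa [Real.norm_eq_abs] at this

/-- The discrete Leibniz rule leaves, besides f and g times each other's second difference, products
of first differences. The Lipschitz bounds make those quadratic in h. -/
lemma IsC11.mul {f g : E d → ℝ} {M N L K : ℝ} (hf : IsC11 M f) (hg : IsC11 N g) (hL0 : 0 ≤ L)
    (hK0 : 0 ≤ K) (hL : ∀ x y, |f x - f y| ≤ L * ‖x - y‖)
    (hK : ∀ x y, |g x - g y| ≤ K * ‖x - y‖) :
    IsC11 (2 * (M * N) + 2 * (L * K)) (fun x => f x * g x) := by
  have hM := hf.nonneg
  have hN := hg.nonneg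
  have hp : ∀ x k : E d, |(f (x + k) - f x) * (g (x + k) - g x)| ≤ L * K * ‖k‖ ^ 2 := by
    intro x k
    have h1 := hL (x + k) x
    have h2 := hK (x + k) x
    rw [add_sub_cancel_left] at h1 h2
    rw [abs_mul]
    calc _ ≤ (L * ‖k‖) * (K * ‖k‖) := mul_le_mul h1 h2 (abs_nonneg _) (by positivity)
      _ = _ := by ring
  have hLK : 0 ≤ L * K := mul_nonneg hL0 hK0
  refine ⟨hf.continuous.mul hg.continuous, fun x => ?_, fun x h => ?_⟩
  · rw [abs_mul]
    have := mul_le_mul (hf.bound x) (hg.bound x) (abs_nonneg _) hM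
    nlinarith [mul_nonneg hM hN]
  · have e : secondDiff (fun x => f x * g x) x h = f x * secondDiff g x h + g x * secondDiff f x h
        - (f (x + h) - f x) * (g (x + h) - g x) - (f (x + -h) - f x) * (g (x + -h) - g x) := by
      simp only [secondDiff, ← sub_eq_add_neg]; ring
    have h1 := abs_le.1 (hp x h)
    have h2 := abs_le.1 (hp x (-h))
    rw [norm_neg] at h2
    have h3 : |f x * secondDiff g x h| ≤ M * (N * ‖h‖ ^ 2) := by
      rw [abs_mul]; exact mul_le_mul (hf.bound x) (hg.second x h) (abs_nonneg _) hM
    have h4 : |g x * secondDiff f x h| ≤ N * (M * ‖h‖ ^ 2) := by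
      rw [abs_mul]; exact mul_le_mul (hg.bound x) (hf.second x h) (abs_nonneg _) hN
    have h3 := abs_le.1 h3
    have h4 := abs_le.1 h4
    rw [e, abs_le]
    constructor <;> nlinarith [h1.1, h1.2, h2.1, h2.2, h3.1, h3.2, h4.1, h4.2]

/-- Second differences commute with convolution, and averaging against a probability density
preserves sup bounds. -/
lemma IsC11.convolution {g : E d → ℝ} {M : ℝ} (hg : IsC11 M g) (φ : ContDiffBump (0 : E d)) :
    IsC11 M (φ.normed volume ⋆[ContinuousLinearMap.lsmul ℝ ℝ, volume] g) := by
  refine ⟨φ.hasCompactSupport_normed.continuous_convolution_left _ φ.continuous_normed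
    hg.continuous.locallyIntegrable, abs_normed_convolution_le φ hg.bound, fun x h => ?_⟩
  have hint : ∀ y, Integrable fun t => φ.normed volume t * g (y - t) := fun y =>
    integrable_mul_of_bound φ.integrable_normed (hg.continuous.comp (continuous_const.sub
      continuous_id)) fun t => hg.bound _
  have e : secondDiff (φ.normed volume ⋆[ContinuousLinearMap.lsmul ℝ ℝ, volume] g) x h =
      (φ.normed volume ⋆[ContinuousLinearMap.lsmul ℝ ℝ, volume] (fun y => secondDiff g y h)) x := by
    simp only [secondDiff, convolution_def, ContinuousLinearMap.lsmul_apply, smul_eq_mul]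
    have hs : Integrable fun t => 2 * (φ.normed volume t * g (x - t)) -
        φ.normed volume t * g (x + h - t) := ((hint x).const_mul 2).sub (hint (x + h))
    rw [← integral_const_mul, ← integral_sub ((hint x).const_mul 2) (hint (x + h)),
      ← integral_sub hs (hint (x - h))]
    refine integral_congr_ae (Eventually.of_forall fun t => ?_)
    simp only
    rw [show x - t + h = x + h - t by abel, show x - t - h = x - h - t by abel]; ring
  rw [e]
  exact abs_normed_convolution_le φ (fun y => hg.second y h) x

/-- A bounded `C²` function with bounded second derivative is the pointwise limit of smooth
compactly supported functions with uniform `C^{1,1}` bounds. -/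
lemma exists_smooth_approx {g : E d → ℝ} (hg : ContDiff ℝ 2 g) {A B : ℝ}
    (hA : ∀ x, |g x| ≤ A) (hB : ∀ x, ‖iteratedFDeriv ℝ 2 g x‖ ≤ B) :
    ∃ (M : ℝ) (ψ : ℕ → E d → ℝ), (∀ n, ContDiff ℝ (↑(⊤ : ℕ∞)) (ψ n)) ∧
      (∀ n, HasCompactSupport (ψ n)) ∧ (∀ n, IsC11 M (ψ n)) ∧
      ∀ x, Tendsto (fun n => ψ n x) atTop (𝓝 (g x)) := by
  obtain ⟨N, hN⟩ := exists_isC11 hg hA hB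
  obtain ⟨K, hK0, hK⟩ := exists_lipschitz_of_contDiff hg hA hB
  set b : ContDiffBump (0 : E d) := ⟨1, 2, one_pos, one_lt_two⟩ with hb
  have hbs : ContDiff ℝ 2 b := b.contDiff
  obtain ⟨A', hA'⟩ := b.hasCompactSupport.exists_bound_of_continuous b.continuous
  obtain ⟨B', hB'⟩ := (b.hasCompactSupport.iteratedFDeriv (𝕜 := ℝ) 2).exists_bound_of_continuous
    (hbs.continuous_iteratedFDeriv (m := 2) le_rfl)
  obtain ⟨M, hM⟩ := exists_isC11 hbs hA' hB'
  obtain ⟨L, hL0, hL⟩ := exists_lipschitz_of_contDiff hbs hA' hB'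
  -- The cutoffs are b(x/(n+1)). Dilation factors at most 1 do not worsen the C^{1,1} and Lipschitz
  -- bounds of b, so the constants are uniform in n.
  set c : ℕ → ℝ := fun n => 1 / ((n : ℝ) + 1) with hc
  have hc0 : ∀ n, 0 < c n := fun n => by simp only [hc]; positivity
  have hc1 : ∀ n, c n ≤ 1 := fun n => by
    simp only [hc]; rw [div_le_one (by positivity)]; linarith [(Nat.cast_nonneg n : (0 : ℝ) ≤ n)]
  set χ : ℕ → E d → ℝ := fun n x => b (c n • x) with hχ
  have hχnorm : ∀ n (x : E d), ‖c n • x‖ ≤ ‖x‖ := fun n x => by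
    rw [norm_smul, Real.norm_eq_abs, abs_of_pos (hc0 n)]
    exact mul_le_of_le_one_left (norm_nonneg x) (hc1 n)
  have hχC : ∀ n, IsC11 M (χ n) := fun n => by
    refine ⟨b.continuous.comp (continuous_const_smul _), fun x => hM.bound _, fun x h => ?_⟩
    have e : secondDiff (χ n) x h = secondDiff b (c n • x) (c n • h) := by
      simp only [secondDiff, hχ, smul_add, smul_sub]
    rw [e]
    refine (hM.second _ _).trans (mul_le_mul_of_nonneg_left ?_ hM.nonneg)
    exact pow_le_pow_left₀ (norm_nonneg _) (hχnorm n h) 2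
  have hχL : ∀ n x y, |χ n x - χ n y| ≤ L * ‖x - y‖ := fun n x y => by
    refine (hL _ _).trans (mul_le_mul_of_nonneg_left ?_ hL0)
    rw [← smul_sub]; exact hχnorm n _
  have hχsupp : ∀ n, HasCompactSupport (χ n) := fun n =>
    b.hasCompactSupport.comp_smul (hc0 n).ne'
  have hprodC : ∀ n, IsC11 (2 * (M * N) + 2 * (L * K)) (fun x => χ n x * g x) := fun n =>
    (hχC n).mul hN hL0 hK0 (hχL n) hK
  refine ⟨2 * (M * N) + 2 * (L * K), fun n => (shrinkingBump (E d) n).normed volume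
    ⋆[ContinuousLinearMap.lsmul ℝ ℝ, volume] (fun x => χ n x * g x), fun n => ?_, fun n => ?_,
    fun n => (hprodC n).convolution _, fun x => ?_⟩
  · exact (shrinkingBump (E d) n).hasCompactSupport_normed.contDiff_convolution_left _
      (shrinkingBump (E d) n).contDiff_normed (hprodC n).continuous.locallyIntegrable
  · exact (shrinkingBump (E d) n).hasCompactSupport_normed.convolution _
      ((hχsupp n).mul_right)
  -- For n ≥ |x|+1 the cutoff equals 1 near x, so the cut-off functions converge jointly in n and
  -- the point, as a shrinking mollifier requires.
  · refine ContDiffBump.convolution_tendsto_right (tendsto_shrinkingBump_rOut (E d))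
      (Eventually.of_forall fun n => (hprodC n).continuous.aestronglyMeasurable) ?_
      tendsto_const_nhds
    have h1 : Tendsto (fun p : ℕ × E d => g p.2) (atTop ×ˢ 𝓝 x) (𝓝 (g x)) :=
      (hg.continuous.tendsto x).comp tendsto_snd
    refine h1.congr' ?_
    have h2 : ∀ᶠ n : ℕ in atTop, ‖x‖ + 1 ≤ (n : ℝ) :=
      tendsto_natCast_atTop_atTop.eventually_ge_atTop _
    have h3 : ∀ᶠ y in 𝓝 x, ‖y‖ < ‖x‖ + 1 :=
      continuous_norm.continuousAt.eventually_lt_const (lt_add_one ‖x‖)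
    filter_upwards [h2.prod_mk h3] with p hp
    have h4 : χ p.1 p.2 = 1 := by
      refine b.one_of_mem_closedBall ?_
      rw [mem_closedBall_zero_iff, norm_smul, Real.norm_eq_abs, abs_of_pos (hc0 _)]
      simp only [hc]
      rw [one_div_mul_eq_div, div_le_one (by positivity)]
      linarith [hp.1, hp.2]
    simp only [Function.uncurry_def, h4, one_mul]

lemma abs_integral_mul_le {v g : E d → ℝ} {C : ℝ} (hv : Integrable v) (hv0 : ∀ᵐ x, 0 ≤ v x)
    (hC : ∀ x, |g x| ≤ C) : |∫ x, v x * g x| ≤ ∫ x, v x * C := by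
  rw [← Real.norm_eq_abs]
  refine norm_integral_le_of_norm_le (hv.mul_const C) ?_
  filter_upwards [hv0] with x hx
  rw [norm_mul, Real.norm_eq_abs, Real.norm_eq_abs, abs_of_nonneg hx]
  exact mul_le_mul_of_nonneg_left (hC x) hx

variable {s T : ℝ} {u : ℝ → E d → ℝ}

/-- The integrated equation tested with a bounded `C²` function with bounded second derivative. -/
lemma IsWeakSolution.sub_eq (hd : 1 ≤ d) (hs0 : 0 < s) (hs1 : s < 1)
    (hu : IsWeakSolution s T u) (hu0 : IsNonneg T u) {g : E d → ℝ} (hg : ContDiff ℝ 2 g) {A B : ℝ}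
    (hA : ∀ x, |g x| ≤ A) (hB : ∀ x, ‖iteratedFDeriv ℝ 2 g x‖ ≤ B)
    {a b : ℝ} (ha : 0 < a) (hab : a ≤ b) (hb : b < T) :
    (∫ x, u b x * g x) - (∫ x, u a x * g x) = -∫ t in a..b, ∫ x, u t x * symLap s g x := by
  obtain ⟨M, ψ, hψs, hψc, hψM, hlim⟩ := exists_smooth_approx hg hA hB
  set C := fracConst d s / 2 * (4 * M * levyMass d s) with hC
  have hsub : Set.uIcc a b ⊆ Set.Ioc 0 T := by
    rw [Set.uIcc_of_le hab]; exact fun t ht => ⟨ha.trans_le ht.1, ht.2.trans hb.le⟩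
  have hpair : ∀ {f : ℕ → E d → ℝ} {h : E d → ℝ} {D : ℝ}, (∀ n, Continuous (f n)) →
      (∀ n x, |f n x| ≤ D) → (∀ x, Tendsto (fun n => f n x) atTop (𝓝 (h x))) →
      ∀ t ∈ Set.Ioc 0 T, Tendsto (fun n => ∫ x, u t x * f n x) atTop (𝓝 (∫ x, u t x * h x)) := by
    intro f h D hfc hfD hfl t ht
    refine tendsto_integral_of_dominated_convergence (fun x => ‖u t x‖ * D)
      (fun n => (integrable_mul_of_bound (hu.integrable t ht) (hfc n)
        (hfD n)).aestronglyMeasurable) ((hu.integrable t ht).norm.mul_const D)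
      (fun n => Eventually.of_forall fun x => ?_)
      (Eventually.of_forall fun x => (hfl x).const_mul _)
    rw [norm_mul]
    exact mul_le_mul_of_nonneg_left (hfD n x) (norm_nonneg _)
  have h1 := (hpair (fun n => (hψM n).continuous) (fun n => (hψM n).bound) hlim b
    (hsub Set.right_mem_uIcc)).sub (hpair (fun n => (hψM n).continuous)
      (fun n => (hψM n).bound) hlim a (hsub Set.left_mem_uIcc))
  have hLlim : ∀ x, Tendsto (fun n => symLap s (ψ n) x) atTop (𝓝 (symLap s g x)) := fun x =>
    tendsto_symLap (x := fun _ => x) hd hs0 hs1 hψM fun h =>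
      (((hlim x).const_mul 2).sub (hlim (x + h))).sub (hlim (x - h))
  have hLc : ∀ n, Continuous (symLap s (ψ n)) := fun n => (hψM n).continuous_symLap hd hs0 hs1
  have hLb : ∀ n x, |symLap s (ψ n) x| ≤ C := fun n => (hψM n).abs_symLap_le hd hs0 hs1
  have h2 : Tendsto (fun n => ∫ t in a..b, ∫ x, u t x * symLap s (ψ n) x) atTop
      (𝓝 (∫ t in a..b, ∫ x, u t x * symLap s g x)) := by
    refine intervalIntegral.tendsto_integral_filter_of_dominated_convergence
      (fun t => ∫ x, u t x * C) (Eventually.of_forall fun n => ?_)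
      (Eventually.of_forall fun n => Eventually.of_forall fun t ht => ?_) ?_
      (Eventually.of_forall fun t ht =>
        hpair hLc hLb hLlim t (hsub (Set.uIoc_subset_uIcc ht)))
    · exact ((hu.continuousOn_pairing (hLc n) (hLb n)).mono
        (Set.uIoc_subset_uIcc.trans hsub)).aestronglyMeasurable measurableSet_uIoc
    · have ht' := hsub (Set.uIoc_subset_uIcc ht)
      rw [Real.norm_eq_abs]
      exact abs_integral_mul_le (hu.integrable t ht') (hu0 t ht') (hLb n)
    · exact ((hu.continuousOn_pairing (g := fun _ => C) continuous_const
        (fun _ => le_rfl)).mono hsub).intervalIntegrable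
  refine tendsto_nhds_unique h1 (h2.neg.congr fun n => ?_)
  rw [hu.sub_eq_of_smooth hd hs0 hs1 (hψs n) (hψc n) ha hab hb]

/-- Pairings of a nonnegative weak solution with bounded `C²` functions with bounded second
derivative are differentiable in time. -/
lemma IsWeakSolution.hasDerivAt_pairing (hd : 1 ≤ d) (hs0 : 0 < s) (hs1 : s < 1)
    (hu : IsWeakSolution s T u) (hu0 : IsNonneg T u) {g : E d → ℝ} (hg : ContDiff ℝ 2 g) {A B : ℝ}
    (hA : ∀ x, |g x| ≤ A) (hB : ∀ x, ‖iteratedFDeriv ℝ 2 g x‖ ≤ B)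
    {t : ℝ} (ht : t ∈ Set.Ioo 0 T) :
    HasDerivAt (fun τ => ∫ x, u τ x * g x) (-∫ x, u t x * symLap s g x) t := by
  obtain ⟨M, hM⟩ := exists_isC11 hg hA hB
  have hcont : ContinuousOn (fun τ => ∫ x, u τ x * symLap s g x) (Set.Ioc 0 T) :=
    hu.continuousOn_pairing (hM.continuous_symLap hd hs0 hs1) (hM.abs_symLap_le hd hs0 hs1)
  have hcont' := hcont.mono Set.Ioo_subset_Ioc_self
  have ht2 : 0 < t / 2 := half_pos ht.1
  have hlt : t / 2 < t := half_lt_self ht.1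
  have h1 : HasDerivAt (fun τ => ∫ r in (t / 2)..τ, ∫ x, u r x * symLap s g x)
      (∫ x, u t x * symLap s g x) t := by
    refine intervalIntegral.integral_hasDerivAt_right
      (ContinuousOn.intervalIntegrable (hcont.mono ?_))
      (hcont'.stronglyMeasurableAtFilter isOpen_Ioo t ht)
      (hcont'.continuousAt (isOpen_Ioo.mem_nhds ht))
    rw [Set.uIcc_of_le hlt.le]
    exact fun r hr => ⟨ht2.trans_le hr.1, hr.2.trans ht.2.le⟩
  have h2 := h1.neg.const_add (∫ x, u (t / 2) x * g x)
  refine h2.congr_of_eventuallyEq ?_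
  filter_upwards [Ioo_mem_nhds hlt ht.2] with τ hτ
  have := hu.sub_eq hd hs0 hs1 hu0 hg hA hB ht2 hτ.1.le hτ.2
  simp only [Pi.neg_apply]
  linarith

end Approximation

/-! ### Decay of the fractional Laplacian -/

section Decay

variable {d : ℕ} {s : ℝ}

/-- The model weight `(1+|x|)^(-β)`. -/
def jap (β : ℝ) (x : E d) : ℝ := (1 + ‖x‖) ^ (-β)

lemma jap_pos (β : ℝ) (x : E d) : 0 < jap β x := by unfold jap; positivity

lemma jap_le_one {β : ℝ} (hβ : 0 ≤ β) (x : E d) : jap β x ≤ 1 :=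
  Real.rpow_le_one_of_one_le_of_nonpos (by linarith [norm_nonneg x]) (by linarith)

lemma continuous_jap (β : ℝ) : Continuous (jap β : E d → ℝ) := by
  unfold jap
  exact Continuous.rpow_const (by fun_prop) fun x => Or.inl (by positivity)

lemma integrable_jap {β : ℝ} (hβ : (d : ℝ) < β) : Integrable (jap β : E d → ℝ) :=
  integrable_one_add_norm (by simpa using hβ)

lemma jap_le_of_half_le {β r : ℝ} (hβ : 0 ≤ β) (x : E d) (hr : (1 + ‖x‖) / 2 ≤ r) :
    r ^ (-β) ≤ 2 ^ β * jap β x := by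
  have h0 : 0 < (1 + ‖x‖) / 2 := by positivity
  refine (Real.rpow_le_rpow_of_nonpos h0 hr (by linarith)).trans_eq ?_
  rw [Real.div_rpow (by positivity) (by norm_num), Real.rpow_neg (by norm_num : (0 : ℝ) ≤ 2), jap]
  field_simp

/-- On a large ball the ratio to `jap` is bounded by compactness; beyond it |x| ≥ 1 makes |x|
comparable with 1+|x|. -/
lemma exists_le_jap {f : E d → ℝ} (hf : Continuous f) {β : ℝ} (hβ : 0 ≤ β)
    (h : ∃ C r : ℝ, 0 < r ∧ ∀ x, r ≤ ‖x‖ → f x ≤ C * ‖x‖ ^ (-β)) :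
    ∃ A, 0 ≤ A ∧ ∀ x, f x ≤ A * jap β x := by
  obtain ⟨C, r, hr, hC⟩ := h
  obtain ⟨D, hD⟩ := (isCompact_closedBall (0 : E d) (max r 1)).exists_bound_of_continuousOn
    (hf.div (continuous_jap β) fun x => (jap_pos β x).ne').continuousOn
  refine ⟨max (|C| * 2 ^ β) D, le_max_of_le_left (by positivity), fun x => ?_⟩
  rcases le_total ‖x‖ (max r 1) with hx | hx
  · have h1 := (le_abs_self _).trans (hD x (by simpa using hx))
    simp only [Pi.div_apply] at h1
    rw [div_le_iff₀ (jap_pos β x)] at h1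
    exact h1.trans (mul_le_mul_of_nonneg_right (le_max_right _ _) (jap_pos β x).le)
  · have hr1 := (le_max_left r 1).trans hx
    have h11 := (le_max_right r 1).trans hx
    refine (hC x hr1).trans ?_
    have h2 : ‖x‖ ^ (-β) ≤ 2 ^ β * jap β x := jap_le_of_half_le hβ x (by linarith)
    calc C * ‖x‖ ^ (-β) ≤ |C| * (2 ^ β * jap β x) :=
          mul_le_mul (le_abs_self C) h2 (Real.rpow_nonneg (norm_nonneg _) _) (abs_nonneg C)
      _ = |C| * 2 ^ β * jap β x := by ring
      _ ≤ _ := mul_le_mul_of_nonneg_right (le_max_left _ _) (jap_pos β x).le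

/-- The fractional Laplacian of a function with the decay of the weight `(1+|x|)^(-(d+2s))`
decays at the same rate. -/
lemma exists_abs_symLap_le_jap (hd : 1 ≤ d) (hs0 : 0 < s) (hs1 : s < 1) {g : E d → ℝ}
    (hg : ContDiff ℝ 2 g) {A B : ℝ} (hA : ∀ x, |g x| ≤ A * jap ((d : ℝ) + 2 * s) x)
    (hB : ∀ x, ‖iteratedFDeriv ℝ 2 g x‖ ≤ B * jap ((d : ℝ) + 2 * s + 2) x) :
    ∃ K, 0 < K ∧ ∀ x, |symLap s g x| ≤ K * jap ((d : ℝ) + 2 * s) x := by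
  set α : ℝ := (d : ℝ) + 2 * s with hα
  have hα0 : 0 ≤ α := by positivity
  have hA0 : 0 ≤ A := nonneg_of_mul_nonneg_left ((abs_nonneg _).trans (hA 0)) (jap_pos _ _)
  have hB0 : 0 ≤ B := nonneg_of_mul_nonneg_left ((norm_nonneg _).trans (hB 0)) (jap_pos _ _)
  set P : ℝ := 2 * B * 2 ^ (α + 2) + 8 * A with hP
  set Q : ℝ := A * 2 ^ α with hQ
  have hP0 : 0 ≤ P := by positivity
  have hQ0 : 0 ≤ Q := by positivity
  have hpt : ∀ x h : E d, |secondDiff g x h * levyKernel d s h| ≤ jap α x *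
      (P * (min 1 (‖h‖ ^ 2) * levyKernel d s h) + Q * (jap α (x + h) + jap α (x - h))) := by
    intro x h
    have hk := levyKernel_nonneg (s := s) h
    have hw := (jap_pos α x).le
    have hmin : 0 ≤ min 1 (‖h‖ ^ 2) := le_min zero_le_one (by positivity)
    rw [abs_mul, abs_of_nonneg hk]
    -- In the near region 1+|y| ≥ (1+|x|)/2 for all y within |h| of x, so the Hessian there is of
    -- order (1+|x|)^{-α-2}. The two spare powers absorb |h|² ≤ (1+|x|)² min(1,|h|²).
    rcases le_total ‖h‖ ((1 + ‖x‖) / 2) with hn | hn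
    · have h1 : ∀ y, ‖y - x‖ ≤ ‖h‖ →
          ‖iteratedFDeriv ℝ 2 g y‖ ≤ B * (2 ^ (α + 2) * jap (α + 2) x) := by
        intro y hy
        refine (hB y).trans (mul_le_mul_of_nonneg_left ?_ hB0)
        refine jap_le_of_half_le (by linarith) x ?_
        have := norm_sub_norm_le x y
        rw [norm_sub_rev] at this
        linarith
      have h2 := secondDiff_le_of_iteratedFDeriv hg h1
      have h3 : ‖h‖ ^ 2 ≤ (1 + ‖x‖) ^ 2 * min 1 (‖h‖ ^ 2) := by
        have hx := norm_nonneg x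
        rcases le_total 1 (‖h‖ ^ 2) with h4 | h4
        · rw [min_eq_left h4, mul_one]
          exact pow_le_pow_left₀ (norm_nonneg _) (by linarith) 2
        · rw [min_eq_right h4]
          exact le_mul_of_one_le_left (by positivity) (one_le_pow₀ (by linarith))
      have h5 : jap (α + 2) x * (1 + ‖x‖) ^ 2 = jap α x := by
        unfold jap
        rw [← Real.rpow_natCast, ← Real.rpow_add (by positivity)]
        congr 1; push_cast; ring
      have h6 : |secondDiff g x h| ≤ jap α x * (2 * B * 2 ^ (α + 2)) * min 1 (‖h‖ ^ 2) := by
        refine h2.trans ?_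
        calc 2 * (B * (2 ^ (α + 2) * jap (α + 2) x)) * ‖h‖ ^ 2
            ≤ 2 * (B * (2 ^ (α + 2) * jap (α + 2) x)) * ((1 + ‖x‖) ^ 2 * min 1 (‖h‖ ^ 2)) :=
              mul_le_mul_of_nonneg_left h3 (by have := (jap_pos (α + 2) x).le; positivity)
          _ = _ := by rw [← h5]; ring
      calc |secondDiff g x h| * levyKernel d s h
          ≤ jap α x * (2 * B * 2 ^ (α + 2)) * min 1 (‖h‖ ^ 2) * levyKernel d s h :=
            mul_le_mul_of_nonneg_right h6 hk
        _ = jap α x * (2 * B * 2 ^ (α + 2) * (min 1 (‖h‖ ^ 2) * levyKernel d s h)) := by ring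
        _ ≤ _ := by
            refine mul_le_mul_of_nonneg_left ?_ hw
            have h7 : 0 ≤ Q * (jap α (x + h) + jap α (x - h)) :=
              mul_nonneg hQ0 (add_pos (jap_pos _ _) (jap_pos _ _)).le
            have h8 : 2 * B * 2 ^ (α + 2) ≤ P := by rw [hP]; linarith
            have := mul_le_mul_of_nonneg_right h8 (mul_nonneg hmin hk)
            linarith
    -- In the far region the kernel itself supplies (1+|x|)^{-α} for the terms at x±h, whose weights
    -- are integrable in h; the term at x already has this decay.
    · have h1 : levyKernel d s h ≤ 2 ^ α * jap α x := by
        unfold levyKernel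
        rw [← Real.rpow_neg (norm_nonneg h)]
        exact jap_le_of_half_le hα0 x hn
      -- Here |h| ≥ 1/2, so min(1,|h|²) ≥ 1/4; this turns 2A into the 8A of `P`.
      have h2 : 1 ≤ 4 * min 1 (‖h‖ ^ 2) := by
        have h3 : 1 / 2 ≤ ‖h‖ := by linarith [norm_nonneg x]
        have h4 : 1 / 4 ≤ ‖h‖ ^ 2 := by nlinarith
        have : 1 / 4 ≤ min 1 (‖h‖ ^ 2) := le_min (by norm_num) h4
        linarith
      have h3 : |secondDiff g x h| ≤ 2 * (A * jap α x) + A * (jap α (x + h) + jap α (x - h)) := by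
        have e1 := abs_le.1 (hA x)
        have e2 := abs_le.1 (hA (x + h))
        have e3 := abs_le.1 (hA (x - h))
        unfold secondDiff
        rw [abs_le]; constructor <;> linarith [e1.1, e1.2, e2.1, e2.2, e3.1, e3.2]
      have h4 : 2 * (A * jap α x) * levyKernel d s h ≤
          jap α x * (8 * A * (min 1 (‖h‖ ^ 2) * levyKernel d s h)) := by
        calc 2 * (A * jap α x) * levyKernel d s h = (2 * (A * jap α x) * levyKernel d s h) * 1 := by
              ring
          _ ≤ (2 * (A * jap α x) * levyKernel d s h) * (4 * min 1 (‖h‖ ^ 2)) :=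
              mul_le_mul_of_nonneg_left h2 (by positivity)
          _ = _ := by ring
      have h5 : A * (jap α (x + h) + jap α (x - h)) * levyKernel d s h ≤
          jap α x * (Q * (jap α (x + h) + jap α (x - h))) := by
        calc _ ≤ A * (jap α (x + h) + jap α (x - h)) * (2 ^ α * jap α x) :=
              mul_le_mul_of_nonneg_left h1
                (mul_nonneg hA0 (add_pos (jap_pos _ _) (jap_pos _ _)).le)
          _ = _ := by rw [hQ]; ring
      have h6 := mul_le_mul_of_nonneg_right h3 hk
      have h7 : 8 * A ≤ P := by
        have : 0 ≤ 2 * B * 2 ^ (α + 2) := by positivity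
        rw [hP]; linarith
      have h8 := mul_le_mul_of_nonneg_left
        (mul_le_mul_of_nonneg_right h7 (mul_nonneg hmin hk)) hw
      rw [mul_add (jap α x)]
      linarith
  have hJ := integrable_min_levyKernel (d := d) hd hs0 hs1
  have hW : Integrable (jap α : E d → ℝ) := integrable_jap (by rw [hα]; linarith)
  set W : ℝ := ∫ y : E d, jap α y with hWdef
  have hc := (fracConst_pos (d := d) hs0 hs1).le
  have hJ0 : 0 ≤ levyMass d s := levyMass_nonneg
  have hW0 : 0 ≤ W := integral_nonneg fun y => (jap_pos α y).le
  -- The summand 1 only serves to make the constant strictly positive.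
  refine ⟨fracConst d s / 2 * (P * levyMass d s + Q * (W + W)) + 1, by positivity, fun x => ?_⟩
  have hi1 : Integrable fun h : E d => jap α (x + h) := hW.comp_add_left x
  have hi2 : Integrable fun h : E d => jap α (x - h) := hW.comp_sub_left x
  have hi3 : Integrable fun h : E d => Q * (jap α (x + h) + jap α (x - h)) :=
    (hi1.add hi2).const_mul Q
  have hi4 : Integrable fun h : E d => P * (min 1 (‖h‖ ^ 2) * levyKernel d s h) := hJ.const_mul P
  have hbound : |∫ h, secondDiff g x h * levyKernel d s h| ≤
      jap α x * (P * levyMass d s + Q * (W + W)) := by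
    rw [← Real.norm_eq_abs]
    refine (norm_integral_le_of_norm_le ((hi4.add hi3).const_mul (jap α x))
      (Eventually.of_forall fun h => ?_)).trans_eq ?_
    · rw [Real.norm_eq_abs]; exact hpt x h
    · simp only [Pi.add_apply]
      rw [integral_const_mul, integral_add hi4 hi3, integral_const_mul, integral_const_mul,
        integral_add hi1 hi2, integral_add_left_eq_self (fun y => jap α y) x,
        integral_sub_left_eq_self (fun y => jap α y) volume x]
      rfl
  unfold symLap
  rw [abs_mul, abs_of_nonneg (by positivity)]
  have h9 := mul_le_mul_of_nonneg_left hbound (show 0 ≤ fracConst d s / 2 by positivity)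
  have h10 := (jap_pos α x).le
  calc _ ≤ _ := h9
    _ = fracConst d s / 2 * (P * levyMass d s + Q * (W + W)) * jap α x := by ring
    _ ≤ _ := by nlinarith

/-- Weights are comparable from below with `(1+|x|)^(-α)`. -/
lemma IsWeight.exists_jap_le {α : ℝ} (hα : 0 ≤ α) {φ : E d → ℝ} (hφ : IsWeight α φ) :
    ∃ c, 0 < c ∧ ∀ x, c * jap α x ≤ φ x := by
  obtain ⟨c, C, r, hc, hr, h⟩ := hφ.decay
  obtain ⟨x₀, -, hx₀⟩ := (isCompact_closedBall (0 : E d) r).exists_isMinOn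
    (Metric.nonempty_closedBall.2 hr.le) hφ.contDiff.continuous.continuousOn
  refine ⟨min c (φ x₀), lt_min hc (hφ.pos x₀), fun x => ?_⟩
  rcases le_total r ‖x‖ with hx | hx
  · refine le_trans ?_ (h x hx).1
    have h1 : jap α x ≤ ‖x‖ ^ (-α) :=
      Real.rpow_le_rpow_of_nonpos (hr.trans_le hx) (by linarith) (by linarith)
    exact mul_le_mul (min_le_left _ _) h1 (jap_pos α x).le hc.le
  · have h1 : φ x₀ ≤ φ x := hx₀ (by simpa using hx)
    refine le_trans ?_ h1
    exact (mul_le_mul (min_le_right _ _) (jap_le_one hα x) (jap_pos α x).le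
      (hφ.pos x₀).le).trans_eq (mul_one _)

lemma IsWeight.exists_le_jap {α : ℝ} (hα : 0 ≤ α) {φ : E d → ℝ} (hφ : IsWeight α φ) :
    ∃ A, 0 ≤ A ∧ ∀ x, |φ x| ≤ A * jap α x := by
  obtain ⟨c, C, r, hc, hr, h⟩ := hφ.decay
  refine FracHeat.exists_le_jap hφ.contDiff.continuous.abs hα ⟨C, r, hr, fun x hx => ?_⟩
  rw [abs_of_pos (hφ.pos x)]; exact (h x hx).2

lemma IsWeight.exists_hessian_le_jap {α : ℝ} (hα : 0 ≤ α) {φ : E d → ℝ} (hφ : IsWeight α φ) :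
    ∃ B, 0 ≤ B ∧ ∀ x, ‖iteratedFDeriv ℝ 2 φ x‖ ≤ B * jap (α + 2) x := by
  obtain ⟨c₀, r, hr, h⟩ := hφ.hessian_decay
  refine FracHeat.exists_le_jap (hφ.contDiff.continuous_iteratedFDeriv (m := 2) le_rfl).norm
    (by linarith) ⟨c₀, r, hr, fun x hx => ?_⟩
  rw [neg_add, ← sub_eq_add_neg]; exact h x hx

lemma le_of_le_mul_jap {β A t : ℝ} (hβ : 0 ≤ β) (hA : 0 ≤ A) {x : E d} (h : t ≤ A * jap β x) :
    t ≤ A :=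
  h.trans (mul_le_of_le_one_right hA (jap_le_one hβ x))

/-- `|(-Δ)^s ψ| ≤ C φ` for test functions `ψ` and weights `φ`. -/
lemma IsWeight.exists_abs_symLap_le (hd : 1 ≤ d) (hs0 : 0 < s) (hs1 : s < 1) {φ : E d → ℝ}
    (hφ : IsWeight ((d : ℝ) + 2 * s) φ) {g : E d → ℝ} (hg : ContDiff ℝ 2 g) {A B : ℝ}
    (hA : ∀ x, |g x| ≤ A * jap ((d : ℝ) + 2 * s) x)
    (hB : ∀ x, ‖iteratedFDeriv ℝ 2 g x‖ ≤ B * jap ((d : ℝ) + 2 * s + 2) x) :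
    ∃ K, 0 < K ∧ ∀ x, |symLap s g x| ≤ K * φ x := by
  obtain ⟨K, hK0, hK⟩ := exists_abs_symLap_le_jap hd hs0 hs1 hg hA hB
  obtain ⟨c, hc0, hc⟩ := hφ.exists_jap_le (by positivity)
  refine ⟨K / c, by positivity, fun x => (hK x).trans ?_⟩
  rw [div_mul_eq_mul_div, le_div_iff₀ hc0, mul_assoc]
  exact mul_le_mul_of_nonneg_left (by linarith [hc x]) hK0.le

lemma exists_abs_le_jap_of_hasCompactSupport {f : E d → ℝ} (hf : Continuous f)
    (hc : HasCompactSupport f) {β : ℝ} (hβ : 0 ≤ β) : ∃ A, 0 ≤ A ∧ ∀ x, |f x| ≤ A * jap β x := by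
  obtain ⟨r, hr⟩ := hc.isCompact.isBounded.subset_ball (0 : E d)
  refine exists_le_jap hf.abs hβ ⟨0, max r 1, by positivity, fun x hx => ?_⟩
  have : f x = 0 := image_eq_zero_of_notMem_tsupport fun hmem => by
    have := hr hmem
    rw [mem_ball_zero_iff] at this
    exact absurd ((le_max_left r 1).trans hx) (not_le.2 this)
  simp [this]

lemma IsWeight.exists_abs_symLap_le_of_hasCompactSupport (hd : 1 ≤ d) (hs0 : 0 < s) (hs1 : s < 1)
    {φ : E d → ℝ} (hφ : IsWeight ((d : ℝ) + 2 * s) φ) {g : E d → ℝ} (hg : ContDiff ℝ 2 g)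
    (hc : HasCompactSupport g) : ∃ K, 0 < K ∧ ∀ x, |symLap s g x| ≤ K * φ x := by
  obtain ⟨A, -, hA⟩ := exists_abs_le_jap_of_hasCompactSupport hg.continuous hc
    (β := (d : ℝ) + 2 * s) (by positivity)
  obtain ⟨B, -, hB⟩ := exists_abs_le_jap_of_hasCompactSupport (β := (d : ℝ) + 2 * s + 2)
    (hg.continuous_iteratedFDeriv (m := 2) le_rfl).norm
    ((hc.iteratedFDeriv (𝕜 := ℝ) 2).norm) (by positivity)
  exact hφ.exists_abs_symLap_le hd hs0 hs1 hg hA fun x => by simpa using hB x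

end Decay

/-! ### Scaling of the weight -/

section Rescale

variable {d : ℕ} {s : ℝ}

lemma contDiff_rescale {φ : E d → ℝ} {n : WithTop ℕ∞} (hφ : ContDiff ℝ n φ) (x₀ : E d) (ρ : ℝ) :
    ContDiff ℝ n (rescale φ x₀ ρ) :=
  hφ.comp ((contDiff_id.sub contDiff_const).const_smul ρ⁻¹)

lemma norm_iteratedFDeriv_rescale_le {φ : E d → ℝ} (hφ : ContDiff ℝ 2 φ) {B : ℝ}
    (hB : ∀ x, ‖iteratedFDeriv ℝ 2 φ x‖ ≤ B) (x₀ : E d) (ρ : ℝ) (x : E d) :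
    ‖iteratedFDeriv ℝ 2 (rescale φ x₀ ρ) x‖ ≤ B * |ρ⁻¹| ^ 2 := by
  set L : E d →L[ℝ] E d := ρ⁻¹ • ContinuousLinearMap.id ℝ (E d) with hL
  have e : rescale φ x₀ ρ = fun x => (φ ∘ L) (x - x₀) := by
    ext x; simp [rescale, hL]
  have hB0 : 0 ≤ B := (norm_nonneg _).trans (hB 0)
  have hLn : ‖L‖ ≤ |ρ⁻¹| := by
    rw [hL, norm_smul, Real.norm_eq_abs]
    exact mul_le_of_le_one_right (abs_nonneg _) ContinuousLinearMap.norm_id_le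
  rw [e, iteratedFDeriv_comp_sub, L.iteratedFDeriv_comp_right hφ _ le_rfl]
  refine (ContinuousMultilinearMap.norm_compContinuousLinearMap_le _ _).trans ?_
  rw [Finset.prod_const, Finset.card_univ, Fintype.card_fin]
  exact mul_le_mul (hB _) (pow_le_pow_left₀ (norm_nonneg _) hLn 2) (by positivity) hB0

/-- Substituting h = ρk, the kernel contributes ρ^{-(d+2s)} and the Jacobian ρ^d. The surviving
ρ^{-2s} is the factor in the exponent of the trace estimate. -/
lemma symLap_rescale {ρ : ℝ} (hρ : 0 < ρ) (φ : E d → ℝ) (x₀ x : E d) :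
    symLap s (rescale φ x₀ ρ) x = ρ ^ (-(2 * s)) * symLap s φ (ρ⁻¹ • (x - x₀)) := by
  have e1 : ∀ h : E d, secondDiff (rescale φ x₀ ρ) x h * levyKernel d s h =
      ρ ^ (-((d : ℝ) + 2 * s)) *
        (secondDiff φ (ρ⁻¹ • (x - x₀)) (ρ⁻¹ • h) * levyKernel d s (ρ⁻¹ • h)) := by
    intro h
    have e2 : secondDiff (rescale φ x₀ ρ) x h = secondDiff φ (ρ⁻¹ • (x - x₀)) (ρ⁻¹ • h) := by
      simp only [secondDiff, rescale, ← smul_add, ← smul_sub]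
      rw [show x + h - x₀ = x - x₀ + h by abel, show x - h - x₀ = x - x₀ - h by abel]
    have e3 : levyKernel d s (ρ⁻¹ • h) = ρ ^ ((d : ℝ) + 2 * s) * levyKernel d s h := by
      unfold levyKernel
      rw [norm_smul, Real.norm_eq_abs, abs_of_pos (inv_pos.2 hρ),
        Real.mul_rpow (inv_pos.2 hρ).le (norm_nonneg h), mul_inv, Real.inv_rpow hρ.le, inv_inv]
    have e4 : ρ ^ (-((d : ℝ) + 2 * s)) * ρ ^ ((d : ℝ) + 2 * s) = 1 := by
      rw [← Real.rpow_add hρ]; simp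
    rw [e2, e3]
    linear_combination (-(secondDiff φ (ρ⁻¹ • (x - x₀)) (ρ⁻¹ • h) * levyKernel d s h)) * e4
  unfold symLap
  simp_rw [e1]
  rw [integral_const_mul, Measure.integral_comp_smul volume
    (fun k => secondDiff φ (ρ⁻¹ • (x - x₀)) k * levyKernel d s k) ρ⁻¹]
  have hdim : Module.finrank ℝ (E d) = d := by simp
  rw [hdim, inv_pow, inv_inv, abs_of_pos (pow_pos hρ d), smul_eq_mul]
  have e5 : ρ ^ (-((d : ℝ) + 2 * s)) * ρ ^ d = ρ ^ (-(2 * s)) := by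
    rw [← Real.rpow_natCast, ← Real.rpow_add hρ]; congr 1; ring
  rw [← e5]; ring

end Rescale

/-! ### Grönwall estimate and initial trace -/

section Trace

variable {d : ℕ} {s T : ℝ} {u : ℝ → E d → ℝ}

/-- Grönwall estimate, backwards in time, for a pairing with a supersolution-type weight. -/
lemma IsWeakSolution.pairing_le_exp_mul (hd : 1 ≤ d) (hs0 : 0 < s) (hs1 : s < 1)
    (hu : IsWeakSolution s T u) (hu0 : IsNonneg T u) {g : E d → ℝ} (hg : ContDiff ℝ 2 g) {A B : ℝ}
    (hA : ∀ x, |g x| ≤ A) (hB : ∀ x, ‖iteratedFDeriv ℝ 2 g x‖ ≤ B) (hg0 : ∀ x, 0 ≤ g x)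
    {K : ℝ} (hK0 : 0 ≤ K) (hK : ∀ x, |symLap s g x| ≤ K * g x) {t : ℝ} (ht : t ∈ Set.Ioc 0 T) :
    ∫ x, u t x * g x ≤ Real.exp (K * T) * ∫ x, u T x * g x := by
  obtain ⟨M, hM⟩ := exists_isC11 hg hA hB
  set Y : ℝ → ℝ := fun τ => ∫ x, u τ x * g x with hY
  have hT : T ∈ Set.Ioc 0 T := ⟨ht.1.trans_le ht.2, le_rfl⟩
  have hYc : ContinuousOn Y (Set.Ioc 0 T) := hu.continuousOn_pairing hg.continuous hA
  have hder : ∀ τ ∈ Set.Ioo 0 T, HasDerivAt (fun τ => Real.exp (K * τ) * Y τ)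
      (Real.exp (K * τ) * K * Y τ + Real.exp (K * τ) * -∫ x, u τ x * symLap s g x) τ := by
    intro τ hτ
    have h1 : HasDerivAt (fun τ => Real.exp (K * τ)) (Real.exp (K * τ) * K) τ := by
      simpa using ((hasDerivAt_id τ).const_mul K).exp
    exact h1.mul (hu.hasDerivAt_pairing hd hs0 hs1 hu0 hg hA hB hτ)
  -- The derivative is e^{Kτ}(KY - ∫ u (-Δ)^s g) ≥ 0 on the open interval; L¹ continuity carries the
  -- monotonicity to the endpoint T.
  have hmono : MonotoneOn (fun τ => Real.exp (K * τ) * Y τ) (Set.Ioc 0 T) := by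
    refine monotoneOn_of_deriv_nonneg (convex_Ioc 0 T)
      ((by fun_prop : Continuous fun τ => Real.exp (K * τ)).continuousOn.mul hYc)
      (fun τ hτ => ?_) (fun τ hτ => ?_) <;> rw [interior_Ioc] at hτ
    · exact (hder τ hτ).differentiableAt.differentiableWithinAt
    · rw [(hder τ hτ).deriv]
      have hτ' := Set.Ioo_subset_Ioc_self hτ
      have h1 : ∫ x, u τ x * symLap s g x ≤ K * Y τ := by
        simp only [hY]
        rw [← integral_const_mul]
        refine integral_mono_ae (integrable_mul_of_bound (hu.integrable τ hτ')
          (hM.continuous_symLap hd hs0 hs1) (hM.abs_symLap_le hd hs0 hs1))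
          ((integrable_mul_of_bound (hu.integrable τ hτ') hg.continuous hA).const_mul K) ?_
        filter_upwards [hu0 τ hτ'] with x hx
        have := mul_le_mul_of_nonneg_left ((le_abs_self _).trans (hK x)) hx
        linarith
      have := mul_nonneg (Real.exp_pos (K * τ)).le (sub_nonneg.2 h1)
      linarith
  have hfin := hmono ht hT ht.2
  have hYt : 0 ≤ Y t := by
    refine integral_nonneg_of_ae ?_
    filter_upwards [hu0 t ht] with x hx using mul_nonneg hx (hg0 x)
  have h2 : 1 ≤ Real.exp (K * t) := Real.one_le_exp (mul_nonneg hK0 ht.1.le)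
  exact (le_mul_of_one_le_left hYt h2).trans hfin

/-- A function on `(0,T)` with bounded derivative has a limit at `0+`. -/
lemma exists_tendsto_of_bounded_deriv {T D : ℝ} (hT : 0 < T) {F F' : ℝ → ℝ}
    (hF : ∀ t ∈ Set.Ioo 0 T, HasDerivAt F (F' t) t) (hD : ∀ t ∈ Set.Ioo 0 T, |F' t| ≤ D) :
    ∃ l, Tendsto F (𝓝[>] 0) (𝓝 l) := by
  have hD0 : 0 ≤ D := (abs_nonneg _).trans (hD (T / 2) ⟨by linarith, by linarith⟩)
  -- A Lipschitz function on (0,T) extends to the whole line, and the value of the extension at 0 is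
  -- the limit.
  have h1 : LipschitzOnWith D.toNNReal F (Set.Ioo 0 T) :=
    (convex_Ioo 0 T).lipschitzOnWith_of_nnnorm_hasDerivWithin_le
      (fun t ht => (hF t ht).hasDerivWithinAt) fun t ht => by
        rw [← NNReal.coe_le_coe, coe_nnnorm, Real.coe_toNNReal _ hD0]; exact hD t ht
  obtain ⟨g, hg, hgF⟩ := h1.extend_real
  refine ⟨g 0, ((hg.continuous.tendsto 0).mono_left nhdsWithin_le_nhds).congr' ?_⟩
  filter_upwards [Ioo_mem_nhdsGT hT] with t ht using (hgF ht).symm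

/-- The error is measured against φ because ∫ u(t)φ is the quantity controlled as t → 0. A
mollification radius of at most 1 keeps f supported in `S`, where φ has a positive minimum. -/
lemma exists_smooth_close {ψ φ : E d → ℝ} (hψ : Continuous ψ) (hψc : HasCompactSupport ψ)
    (hφ : Continuous φ) (hφ0 : ∀ x, 0 < φ x) {ε : ℝ} (hε : 0 < ε) :
    ∃ f : E d → ℝ, ContDiff ℝ (↑(⊤ : ℕ∞)) f ∧ HasCompactSupport f ∧
      ∀ x, |f x - ψ x| ≤ ε * φ x := by
  set S := Metric.cthickening 1 (tsupport ψ) with hS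
  have hSc : IsCompact S := hψc.isCompact.cthickening
  obtain ⟨m, hm0, hm⟩ : ∃ m, 0 < m ∧ ∀ x ∈ S, m ≤ φ x := by
    rcases S.eq_empty_or_nonempty with h | h
    · exact ⟨1, one_pos, fun x hx => by rw [h] at hx; exact absurd hx (Set.notMem_empty x)⟩
    · obtain ⟨x₀, -, hx₀⟩ := hSc.exists_isMinOn h hφ.continuousOn
      exact ⟨φ x₀, hφ0 x₀, fun x hx => hx₀ hx⟩
  have huc := hψc.uniformContinuous_of_continuous hψ
  obtain ⟨δ, hδ, hδψ⟩ := Metric.uniformContinuous_iff.1 huc (ε * m) (by positivity)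
  obtain ⟨f, hf, hfψ⟩ := hψ.exists_contDiff_dist_le_of_forall_mem_ball_dist_le
    (lt_min one_pos hδ)
  have hout : ∀ x, x ∉ S → ψ x = 0 ∧ f x = 0 := by
    intro x hx
    have h0 : ∀ y ∈ Metric.ball x (min 1 δ), ψ y = 0 := fun y hy =>
      image_eq_zero_of_notMem_tsupport fun hmem => hx
        (Metric.mem_cthickening_of_dist_le x y 1 _ hmem (by
          rw [dist_comm]; exact ((Metric.mem_ball.1 hy).trans_le (min_le_left _ _)).le))
    have h1 : ψ x = 0 := h0 x (Metric.mem_ball_self (lt_min one_pos hδ))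
    -- Tolerance 0 is admissible where ψ vanishes on the whole ball, and it forces f(x) = 0 exactly.
    have h2 := hfψ x 0 fun y hy => by rw [h0 y hy, h1, dist_self]
    rw [h1] at h2
    exact ⟨h1, dist_le_zero.1 h2⟩
  refine ⟨f, hf, HasCompactSupport.intro hSc fun x hx => (hout x hx).2, fun x => ?_⟩
  by_cases hx : x ∈ S
  · have h1 := hfψ x (ε * m) fun y hy =>
      (hδψ ((Metric.mem_ball.1 hy).trans_le (min_le_right _ _))).le
    rw [Real.dist_eq] at h1
    exact h1.trans (mul_le_mul_of_nonneg_left (hm x hx) hε.le)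
  · rw [(hout x hx).1, (hout x hx).2, sub_zero, abs_zero]
    exact mul_nonneg hε.le (hφ0 x).le

lemma abs_integral_mul_le_of_abs_le {v f g : E d → ℝ} {A : ℝ} (hv : Integrable v)
    (hv0 : ∀ᵐ x, 0 ≤ v x) (hg : Continuous g) (hA : ∀ x, |g x| ≤ A) {ε : ℝ}
    (hfg : ∀ x, |f x| ≤ ε * g x) : |∫ x, v x * f x| ≤ ε * ∫ x, v x * g x := by
  rw [← integral_const_mul, ← Real.norm_eq_abs]
  refine norm_integral_le_of_norm_le ((integrable_mul_of_bound hv hg hA).const_mul ε) ?_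
  filter_upwards [hv0] with x hx
  rw [norm_mul, Real.norm_eq_abs, Real.norm_eq_abs, abs_of_nonneg hx]
  have := mul_le_mul_of_nonneg_left (hfg x) hx
  linarith

/-- Pairings with continuous compactly supported functions converge as `t → 0+`. -/
lemma IsWeakSolution.exists_tendsto_pairing (hd : 1 ≤ d) (hs0 : 0 < s) (hs1 : s < 1) (hT : 0 < T)
    (hu : IsWeakSolution s T u) (hu0 : IsNonneg T u) {φ : E d → ℝ}
    (hφ : IsWeight ((d : ℝ) + 2 * s) φ) {ψ : E d → ℝ} (hψ : Continuous ψ)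
    (hψc : HasCompactSupport ψ) :
    ∃ l, Tendsto (fun t => ∫ x, u t x * ψ x) (𝓝[>] 0) (𝓝 l) := by
  have hα : (0 : ℝ) ≤ (d : ℝ) + 2 * s := by positivity
  obtain ⟨A, hA0, hA⟩ := hφ.exists_le_jap hα
  obtain ⟨B, hB0, hB⟩ := hφ.exists_hessian_le_jap hα
  obtain ⟨K, hK0, hK⟩ := hφ.exists_abs_symLap_le hd hs0 hs1 hφ.contDiff hA hB
  have hA' : ∀ x, |φ x| ≤ A := fun x => le_of_le_mul_jap hα hA0 (hA x)
  have hB' : ∀ x, ‖iteratedFDeriv ℝ 2 φ x‖ ≤ B := fun x =>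
    le_of_le_mul_jap (by linarith) hB0 (hB x)
  set D := Real.exp (K * T) * ∫ x, u T x * φ x with hDdef
  have hD : ∀ t ∈ Set.Ioc 0 T, ∫ x, u t x * φ x ≤ D := fun t ht =>
    hu.pairing_le_exp_mul hd hs0 hs1 hu0 hφ.contDiff hA' hB' (fun x => (hφ.pos x).le) hK0.le hK ht
  have hD0 : 0 ≤ D := by
    refine le_trans (integral_nonneg_of_ae ?_) (hD T ⟨hT, le_rfl⟩)
    filter_upwards [hu0 T ⟨hT, le_rfl⟩] with x hx using mul_nonneg hx (hφ.pos x).le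
  have hsmooth : ∀ f : E d → ℝ, ContDiff ℝ (↑(⊤ : ℕ∞)) f → HasCompactSupport f →
      ∃ l, Tendsto (fun t => ∫ x, u t x * f x) (𝓝[>] 0) (𝓝 l) := by
    intro f hf hfc
    have hf2 : ContDiff ℝ 2 f := contDiff_infty.1 hf 2
    obtain ⟨C, hC0, hC⟩ := hφ.exists_abs_symLap_le_of_hasCompactSupport hd hs0 hs1 hf2 hfc
    obtain ⟨A₁, hA₁⟩ := hfc.exists_bound_of_continuous hf2.continuous
    obtain ⟨B₁, hB₁⟩ := (hfc.iteratedFDeriv (𝕜 := ℝ) 2).exists_bound_of_continuous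
      (hf2.continuous_iteratedFDeriv (m := 2) le_rfl)
    refine exists_tendsto_of_bounded_deriv (D := C * D) hT
      (fun t ht => hu.hasDerivAt_pairing hd hs0 hs1 hu0 hf2 hA₁ hB₁ ht) fun t ht => ?_
    have ht' := Set.Ioo_subset_Ioc_self ht
    rw [abs_neg]
    exact (abs_integral_mul_le_of_abs_le (hu.integrable t ht') (hu0 t ht') hφ.contDiff.continuous
      hA' hC).trans (mul_le_mul_of_nonneg_left (hD t ht') hC0.le)
  obtain ⟨A₂, hA₂⟩ := hψc.exists_bound_of_continuous hψ
  refine cauchy_map_iff_exists_tendsto.1 (Metric.cauchy_iff.2 ⟨inferInstance, fun ε hε => ?_⟩)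
  -- With D + 1 in the denominator the choice makes sense for D = 0 and still gives ηD < ε/4.
  set η := ε / (4 * (D + 1)) with hη
  have hη0 : 0 < η := by positivity
  have hηD : η * D < ε / 4 := by
    rw [hη, div_mul_eq_mul_div, div_lt_div_iff₀ (by positivity) (by norm_num)]
    nlinarith
  obtain ⟨f, hf, hfc, hfψ⟩ := exists_smooth_close hψ hψc hφ.contDiff.continuous hφ.pos hη0
  obtain ⟨l, hl⟩ := hsmooth f hf hfc
  obtain ⟨A₁, hA₁⟩ := hfc.exists_bound_of_continuous hf.continuous
  have hev : ∀ᶠ t in 𝓝[>] (0 : ℝ), dist (∫ x, u t x * ψ x) l < ε / 2 := by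
    filter_upwards [hl (Metric.ball_mem_nhds l (by positivity : 0 < ε / 4)),
      Ioc_mem_nhdsGT hT] with t ht htm
    have h1 : |(∫ x, u t x * f x) - ∫ x, u t x * ψ x| ≤ η * D := by
      rw [← integral_sub (integrable_mul_of_bound (hu.integrable t htm) hf.continuous hA₁)
        (integrable_mul_of_bound (hu.integrable t htm) hψ hA₂)]
      simp_rw [← mul_sub]
      exact (abs_integral_mul_le_of_abs_le (hu.integrable t htm) (hu0 t htm)
        hφ.contDiff.continuous hA' hfψ).trans (mul_le_mul_of_nonneg_left (hD t htm) hη0.le)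
    have h2 : dist (∫ x, u t x * f x) l < ε / 4 := ht
    rw [← Real.dist_eq, dist_comm] at h1
    linarith [dist_triangle (∫ x, u t x * ψ x) (∫ x, u t x * f x) l]
  refine ⟨_, image_mem_map hev, ?_⟩
  rintro _ ⟨t, ht, rfl⟩ _ ⟨t', ht', rfl⟩
  have ht1 : dist (∫ x, u t x * ψ x) l < ε / 2 := ht
  have ht2 : dist (∫ x, u t' x * ψ x) l < ε / 2 := ht'
  linarith [dist_triangle_right (∫ x, u t x * ψ x) (∫ x, u t' x * ψ x) l]

open scoped CompactlySupported

/-- If pairings with continuous compactly supported functions converge, then a nonnegative curve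
has an initial trace. -/
lemma exists_isInitialTrace (hT : 0 < T) (hu : ∀ t ∈ Set.Ioc 0 T, Integrable (u t) volume)
    (hu0 : IsNonneg T u)
    (hlim : ∀ ψ : E d → ℝ, Continuous ψ → HasCompactSupport ψ →
      ∃ l, Tendsto (fun t => ∫ x, u t x * ψ x) (𝓝[>] 0) (𝓝 l)) :
    ∃ μ : Measure (E d), IsInitialTrace u μ := by
  choose! Λ hΛ using hlim
  have hint : ∀ t ∈ Set.Ioc 0 T, ∀ ψ : C_c(E d, ℝ), Integrable fun x => u t x * ψ x := by
    intro t ht ψ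
    obtain ⟨A, hA⟩ := ψ.hasCompactSupport.exists_bound_of_continuous ψ.continuous
    exact integrable_mul_of_bound (hu t ht) ψ.continuous hA
  let L : C_c(E d, ℝ) →ₗ[ℝ] ℝ :=
    -- Linearity, and below positivity, pass from the pairings at positive times to their limits.
    { toFun := fun ψ => Λ ψ
      map_add' := fun ψ χ => by
        refine tendsto_nhds_unique (hΛ (ψ + χ : C_c(E d, ℝ)) (map_continuous _)
          (ψ + χ).hasCompactSupport)
          (((hΛ ψ (map_continuous ψ) ψ.hasCompactSupport).add
            (hΛ χ (map_continuous χ) χ.hasCompactSupport)).congr' ?_)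
        filter_upwards [Ioc_mem_nhdsGT hT] with t ht
        rw [← integral_add (hint t ht ψ) (hint t ht χ)]
        simp [mul_add]
      map_smul' := fun c ψ => by
        refine tendsto_nhds_unique (hΛ (c • ψ : C_c(E d, ℝ)) (map_continuous _)
          (c • ψ).hasCompactSupport)
          (((hΛ ψ (map_continuous ψ) ψ.hasCompactSupport).const_mul c).congr' ?_)
        filter_upwards with t
        rw [← integral_const_mul]
        simp [mul_left_comm] }
  let P : C_c(E d, ℝ) →ₚ[ℝ] ℝ := PositiveLinearMap.mk₀ L fun ψ hψ => by
    refine ge_of_tendsto (hΛ ψ (map_continuous ψ) ψ.hasCompactSupport) ?_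
    filter_upwards [Ioc_mem_nhdsGT hT] with t ht
    refine integral_nonneg_of_ae ?_
    filter_upwards [hu0 t ht] with x hx using mul_nonneg hx (hψ x)
  refine ⟨RealRMK.rieszMeasure P, inferInstance, fun ψ hψ hψc => ?_⟩
  have h1 := RealRMK.integral_rieszMeasure P ⟨⟨ψ, hψ⟩, hψc⟩
  have h2 : (∫ x, ψ x ∂(RealRMK.rieszMeasure P)) = Λ ψ := h1
  rw [h2]
  exact hΛ ψ hψ hψc

lemma IsInitialTrace.unique {μ ν : Measure (E d)} (hμ : IsInitialTrace u μ)
    (hν : IsInitialTrace u ν) : μ = ν := by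
  have := hμ.radon
  have := hν.radon
  exact Measure.ext_of_integral_eq_on_compactlySupported fun ψ =>
    tendsto_nhds_unique (hμ.tendsto ψ ψ.continuous ψ.hasCompactSupport)
      (hν.tendsto ψ ψ.continuous ψ.hasCompactSupport)

lemma weightedL1Norm_eq_ofReal {v g : E d → ℝ} (hvg : Integrable fun x => v x * g x)
    (hv0 : ∀ᵐ x, 0 ≤ v x) (hg0 : ∀ x, 0 ≤ g x) :
    weightedL1Norm v g = ENNReal.ofReal (∫ x, v x * g x) := by
  have hnn : ∀ᵐ x, 0 ≤ v x * g x := by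
    filter_upwards [hv0] with x hx using mul_nonneg hx (hg0 x)
  rw [ofReal_integral_eq_lintegral_ofReal hvg hnn, weightedL1Norm]
  refine lintegral_congr_ae ?_
  filter_upwards [hv0] with x hx
  rw [Real.enorm_of_nonneg hx, ENNReal.ofReal_mul hx]

/-- An initial trace is bounded on open sets by any uniform bound for the pairings with a weight
that is at least one there. -/
lemma IsInitialTrace.measure_le {μ : Measure (E d)} (hμ : IsInitialTrace u μ) (hT : 0 < T)
    (hu : ∀ t ∈ Set.Ioc 0 T, Integrable (u t) volume) (hu0 : IsNonneg T u) {g : E d → ℝ}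
    (hg : Continuous g) {A : ℝ} (hA : ∀ x, |g x| ≤ A) (hg0 : ∀ x, 0 ≤ g x) {U : Set (E d)}
    (hU : IsOpen U) (hgU : ∀ x ∈ U, 1 ≤ g x) {D : ℝ}
    (hD : ∀ t ∈ Set.Ioc 0 T, ∫ x, u t x * g x ≤ D) : μ U ≤ ENNReal.ofReal D := by
  have := hμ.radon
  -- By inner regularity it suffices to bound compact S ⊆ U. A Urysohn function ψ between the
  -- indicators of S and U is an admissible test, and it lies below g.
  rw [hU.measure_eq_iSup_isCompact]
  refine iSup₂_le fun S hSU => iSup_le fun hS => ?_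
  obtain ⟨ψ, hψ1, hψ0, hψc, hψI⟩ := exists_continuous_one_zero_of_isCompact hS
    hU.isClosed_compl (Set.disjoint_compl_right_iff_subset.2 hSU)
  have hψi : Integrable ψ μ := ψ.continuous.integrable_of_hasCompactSupport hψc
  have h1 : μ S ≤ ENNReal.ofReal (∫ x, ψ x ∂μ) := by
    rw [ofReal_integral_eq_lintegral_ofReal hψi (Eventually.of_forall fun x => (hψI x).1),
      ← lintegral_indicator_one hS.measurableSet]
    refine lintegral_mono fun x => ?_
    by_cases hx : x ∈ S
    · simp [hx, hψ1 hx]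
    · simp [hx]
  refine h1.trans (ENNReal.ofReal_le_ofReal ?_)
  refine le_of_tendsto (hμ.tendsto ψ ψ.continuous hψc) ?_
  filter_upwards [Ioc_mem_nhdsGT hT] with t ht
  refine le_trans (integral_mono_ae ?_ (integrable_mul_of_bound (hu t ht) hg hA) ?_) (hD t ht)
  · exact integrable_mul_of_bound (M := 1) (hu t ht) ψ.continuous fun x => by
      rw [abs_of_nonneg (hψI x).1]; exact (hψI x).2
  · filter_upwards [hu0 t ht] with x hx
    refine mul_le_mul_of_nonneg_left ?_ hx
    by_cases hxU : x ∈ U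
    · exact (hψI x).2.trans (hgU x hxU)
    · rw [hψ0 hxU]; exact hg0 x

end Trace

end FracHeat

end

/-! ### Assembly of the theorem -/

theorem mainTheorem8 (d : ℕ) (hd : 1 ≤ d) (s : ℝ) (hs0 : 0 < s) (hs1 : s < 1)
    (φ : FracHeat.E d → ℝ) (hφ : FracHeat.IsWeight ((d : ℝ) + 2 * s) φ) :
    (∃ K₀ : ℝ, 0 < K₀ ∧ ∀ x, |FracHeat.fracLaplacian s φ x| ≤ K₀ * φ x) ∧
    ∀ T : ℝ, 0 < T → ∀ u : ℝ → FracHeat.E d → ℝ,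
      FracHeat.IsWeakSolution s T u → FracHeat.IsNonneg T u →
      FracHeat.weightedL1Norm (u T) φ < ⊤ →
      (∃! μ : Measure (FracHeat.E d), FracHeat.IsInitialTrace u μ) ∧
      ∀ μ : Measure (FracHeat.E d), FracHeat.IsInitialTrace u μ →
        ∀ K₀ : ℝ, (∀ x, |FracHeat.fracLaplacian s φ x| ≤ K₀ * φ x) →
        ∀ (x₀ : FracHeat.E d) (R ρ : ℝ), 0 < R → 0 < ρ →
          (∀ x ∈ Metric.ball x₀ R, 1 ≤ FracHeat.rescale φ x₀ ρ x) →
          FracHeat.weightedL1Norm (u T) (FracHeat.rescale φ x₀ ρ) < ⊤ ∧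
          μ (Metric.ball x₀ R) ≤
            ENNReal.ofReal (Real.exp (K₀ * ρ ^ (-(2 * s)) * T)) *
              FracHeat.weightedL1Norm (u T) (FracHeat.rescale φ x₀ ρ) := by
  have hα : (0 : ℝ) ≤ (d : ℝ) + 2 * s := by positivity
  obtain ⟨A, hA0, hAj⟩ := hφ.exists_le_jap hα
  obtain ⟨B, hB0, hBj⟩ := hφ.exists_hessian_le_jap hα
  have hA : ∀ x, |φ x| ≤ A := fun x => FracHeat.le_of_le_mul_jap hα hA0 (hAj x)
  have hB : ∀ x, ‖iteratedFDeriv ℝ 2 φ x‖ ≤ B := fun x =>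
    FracHeat.le_of_le_mul_jap (by linarith) hB0 (hBj x)
  obtain ⟨M, hM⟩ := FracHeat.exists_isC11 hφ.contDiff hA hB
  have hLap : ∀ x, FracHeat.fracLaplacian s φ x = FracHeat.symLap s φ x :=
    hM.fracLaplacian_eq hd hs0 hs1
  refine ⟨?_, fun T hT u hu hu0 _ => ⟨?_, fun μ hμ K₀ hK x₀ R ρ _ hρ hge => ?_⟩⟩
  · simp_rw [hLap]
    exact hφ.exists_abs_symLap_le hd hs0 hs1 hφ.contDiff hAj hBj
  · obtain ⟨μ, hμ⟩ := FracHeat.exists_isInitialTrace hT hu.integrable hu0 fun ψ hψ hψc =>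
      hu.exists_tendsto_pairing hd hs0 hs1 hT hu0 hφ hψ hψc
    exact ⟨μ, hμ, fun ν hν => hν.unique hμ⟩
  · have hTm : T ∈ Set.Ioc 0 T := ⟨hT, le_rfl⟩
    have hK0 : 0 ≤ K₀ :=
      nonneg_of_mul_nonneg_left ((abs_nonneg _).trans (hK 0)) (hφ.pos 0)
    set g := FracHeat.rescale φ x₀ ρ with hg
    have hg2 : ContDiff ℝ 2 g := FracHeat.contDiff_rescale hφ.contDiff x₀ ρ
    have hg0 : ∀ x, 0 ≤ g x := fun x => (hφ.pos _).le
    have hgA : ∀ x, |g x| ≤ A := fun x => hA _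
    have hgB : ∀ x, ‖iteratedFDeriv ℝ 2 g x‖ ≤ B * |ρ⁻¹| ^ 2 :=
      FracHeat.norm_iteratedFDeriv_rescale_le hφ.contDiff hB x₀ ρ
    have hρs : 0 < ρ ^ (-(2 * s)) := Real.rpow_pos_of_pos hρ _
    -- The hypothesis on K₀ at the point (x-x₀)/ρ, transported by scaling, is the Grönwall
    -- hypothesis for the rescaled weight.
    have hgK : ∀ x, |FracHeat.symLap s g x| ≤ K₀ * ρ ^ (-(2 * s)) * g x := by
      intro x
      have h1 := hK (ρ⁻¹ • (x - x₀))
      rw [hLap] at h1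
      rw [hg, FracHeat.symLap_rescale hρ, abs_mul, abs_of_pos hρs]
      calc _ ≤ ρ ^ (-(2 * s)) * (K₀ * φ (ρ⁻¹ • (x - x₀))) :=
            mul_le_mul_of_nonneg_left h1 hρs.le
        _ = _ := by rw [FracHeat.rescale]; ring
    -- The rescaled weight is bounded and u(T) is in L¹, so the weighted norm is a convergent
    -- integral; this also gives its finiteness.
    have hnorm := FracHeat.weightedL1Norm_eq_ofReal
      (FracHeat.integrable_mul_of_bound (hu.integrable T hTm) hg2.continuous hgA)
      (hu0 T hTm) hg0
    rw [hnorm, ← ENNReal.ofReal_mul (Real.exp_pos _).le]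
    refine ⟨ENNReal.ofReal_lt_top, ?_⟩
    exact hμ.measure_le hT hu.integrable hu0 hg2.continuous hgA hg0 Metric.isOpen_ball hge
      fun t ht => hu.pairing_le_exp_mul hd hs0 hs1 hu0 hg2 hgA hgB hg0
        (mul_nonneg hK0 hρs.le) hgK ht
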